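/- Let $R$ be a commutative artinian ring and let $\mathcal{C}$ be a dualizing $R$-variety. That is, $\mathcal{C}$ is a small additive $R$-linear category in which idempotents split, every $\mathrm{Hom}_{\mathcal{C}}(X,Y)$ is a finitely generated $R$-module, and $M\mapsto \mathrm{Hom}_R(M(-),E)$, with $E$ the injective envelope of $R/\mathrm{rad}(R)$, induces a duality between $\mathrm{mod}(\mathcal{C})$ and $\mathrm{mod}(\mathcal{C}^{op})$. Here $\mathrm{mod}(\mathcal{C})$ is the category of finitely presented $\mathcal{C}$-modules, i.e. of those additive functors $M$ from $\mathcal{C}$ to abelian groups (equivalently, $R$-linear functors from $\mathcal{C}$ to $R$-modules) for which there is an exact sequence $\mathrm{Hom}_{\mathcal{C}}(C_0,-)\to \mathrm{Hom}_{\mathcal{C}}(C_1,-)\to M\to 0$. Let $C\in\mathcal{C}$, let $P=\mathrm{Hom}_{\mathcal{C}}(C,-)\in\mathrm{mod}(\mathcal{C})$, let $R_P=\mathrm{End}_{\mathrm{mod}(\mathcal{C})}(P)^{op}$, and let $J\in\mathrm{mod}(\mathcal{C})$ be the injective envelope of $P/\mathrm{rad}(P)$, where $\mathrm{rad}(P)$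 is the intersection of the maximal submodules of $P$. Write $\mathrm{add}(X)$ for the class of direct summands of finite direct sums of copies of $X$. For $0\le k\le\infty$ let - $\mathbb{P}_k$ be the full subcategory of those $X\in\mathrm{mod}(\mathcal{C})$ that have a projective resolution $\cdots\to Q_1\to Q_0\to X\to 0$ in $\mathrm{mod}(\mathcal{C})$ with $Q_i\in\mathrm{add}(P)$ for all integers $0\le i\le k$; - $\mathbb{I}_k$ be the full subcategory of those $Y\in\mathrm{mod}(\mathcal{C})$ that have an injective coresolution $0\to Y\to I_0\to I_1\to\cdots$ in $\mathrm{mod}(\mathcal{C})$ with $I_i\in\mathrm{add}(J)$ for all integers $0\le i\le k$. Then: (a) $\mathbb{I}_1=\mathbb{I}_\infty$ if and only if $P^{*}(C')=\mathrm{Hom}_{\mathrm{mod}(\mathcal{C})}(P,\mathrm{Hom}_{\mathcal{C}}(C',-))$ is a projective $R_P$-module (with $R_P$ acting by precomposition) for all $C'\in\mathcal{C}$. (b) $\mathbb{P}_1=\mathbb{P}_\infty$ if and only if $P(C')\simeq\mathrm{Hom}_{\mathrm{mod}(\mathcal{C})}(\mathrm{Hom}_{\mathcal{C}}(C',-),P)$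 is a projective $R_P^{op}$-module (with $R_P^{op}=\mathrm{End}_{\mathrm{mod}(\mathcal{C})}(P)$ acting by postcomposition) for all $C'\in\mathcal{C}$. -/

import Mathlib

open CategoryTheory Limits Opposite

universe v u

namespace DualizingVariety

section Linear

variable {R : Type v} [CommRing R] {C : Type u} [Category.{v} C] [Preadditive C] [Linear R C]

/-- The opposite of an `R`-category is an `R`-category, with `r • f` computed in `C`. -/
instance linearOpposite : Linear R Cᵒᵖ where
  homModule X Y :=
    { smul := fun r f => (r • f.unop).op
      one_smul := fun f => Quiver.Hom.unop_inj (one_smul R f.unop)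
      mul_smul := fun r s f => Quiver.Hom.unop_inj (mul_smul r s f.unop)
      smul_zero := fun r => Quiver.Hom.unop_inj (smul_zero (A := unop Y ⟶ unop X) r)
      smul_add := fun r f g => Quiver.Hom.unop_inj (smul_add r f.unop g.unop)
      add_smul := fun r s f => Quiver.Hom.unop_inj (add_smul r s f.unop)
      zero_smul := fun f => Quiver.Hom.unop_inj (zero_smul R f.unop) }
  smul_comp _ _ _ r f g := Quiver.Hom.unop_inj (Linear.comp_smul _ _ _ g.unop r f.unop)
  comp_smul _ _ _ f r g := Quiver.Hom.unop_inj (Linear.smul_comp _ _ _ r g.unop f.unop)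

end Linear

/-! ### Finitely presented modules -/

section Modules

variable (R : Type v) [CommRing R] (C : Type u) [Category.{v} C] [Preadditive C] [Linear R C]

/-- A functor `M : C ⥤ ModuleCat R` is finitely presented if there is an exact sequence
`Hom(C₀, -) ⟶ Hom(C₁, -) ⟶ M ⟶ 0`.  Exactness is tested at every object.
Such a functor is automatically additive and `R`-linear
(`finitelyPresented_map_add`, `finitelyPresented_map_smul`). -/
def IsFinitelyPresented : ObjectProperty (C ⥤ ModuleCat.{v} R) := fun M =>
  ∃ (C₀ C₁ : C)
    (f : (linearCoyoneda R C).obj (op C₀) ⟶ (linearCoyoneda R C).obj (op C₁))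
    (g : (linearCoyoneda R C).obj (op C₁) ⟶ M),
    (∀ X : C, Function.Exact (f.app X).hom (g.app X).hom) ∧
    (∀ X : C, Function.Surjective (g.app X).hom)

/-- The category `mod(C)` of finitely presented `C`-modules.  The category `Mod(C)` of all
`C`-modules is identified with the category of `R`-linear functors from `C` to `R`-modules. -/
abbrev FPMod := (IsFinitelyPresented R C).FullSubcategory

variable {R C}

theorem finitelyPresented_map_add {M : C ⥤ ModuleCat.{v} R} (hM : IsFinitelyPresented R C M)
    {X Y : C} (f g : X ⟶ Y) : M.map (f + g) = M.map f + M.map g := by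
  obtain ⟨C₀, C₁, a, p, -, hp⟩ := hM
  ext x
  obtain ⟨y, rfl⟩ := hp X x
  have key : ∀ h : X ⟶ Y, (M.map h).hom ((p.app X).hom y) =
      (p.app Y).hom (((linearCoyoneda R C).obj (op C₁)).map h y) := fun h =>
    (LinearMap.congr_fun (congrArg ModuleCat.Hom.hom (p.naturality h)) y).symm
  rw [ModuleCat.hom_add, LinearMap.add_apply, key, key, key, Functor.map_add, ← map_add]
  rfl

theorem finitelyPresented_map_smul {M : C ⥤ ModuleCat.{v} R} (hM : IsFinitelyPresented R C M)
    {X Y : C} (r : R) (f : X ⟶ Y) : M.map (r • f) = r • M.map f := by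
  obtain ⟨C₀, C₁, a, p, -, hp⟩ := hM
  ext x
  obtain ⟨y, rfl⟩ := hp X x
  have key : ∀ h : X ⟶ Y, (M.map h).hom ((p.app X).hom y) =
      (p.app Y).hom (((linearCoyoneda R C).obj (op C₁)).map h y) := fun h =>
    (LinearMap.congr_fun (congrArg ModuleCat.Hom.hom (p.naturality h)) y).symm
  rw [ModuleCat.hom_smul, LinearMap.smul_apply, key, key, ← map_smul]
  exact congrArg _ (Linear.comp_smul _ _ _ (y : C₁ ⟶ X) r f)

variable (R) in
/-- The representable module `Hom_C(c, -)`, an object of `mod(C)`. -/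
def rep (c : C) : FPMod R C :=
  ⟨(linearCoyoneda R C).obj (op c), c, c, 0, 𝟙 _, fun X => by
    intro y
    constructor
    · intro hy
      exact ⟨0, by rw [map_zero]; exact hy.symm⟩
    · rintro ⟨z, rfl⟩
      rfl, fun X y => ⟨y, rfl⟩⟩

/-- Exactness of `F ⟶ G ⟶ H` at `G`, tested at every object of `C`. -/
def ExactSeq {F G H : FPMod R C} (f : F ⟶ G) (g : G ⟶ H) : Prop :=
  ∀ X : C, Function.Exact (f.hom.app X).hom (g.hom.app X).hom

/-- `Q` belongs to `add(P)`, i.e. it is a direct summand of `Pⁿ` for some `n`: there are maps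
`Q ⟶ Pⁿ ⟶ Q`, given by their components, whose composite is the identity. -/
def IsInAdd (P Q : FPMod R C) : Prop :=
  ∃ (n : ℕ) (s : Fin n → (Q ⟶ P)) (r : Fin n → (P ⟶ Q)), ∑ i, s i ≫ r i = 𝟙 Q

end Modules

/-! ### Injective envelopes and dualizing varieties -/

/-- `f : A ⟶ B` is an injective envelope: `B` is injective and `f` is an essential
monomorphism. -/
structure IsInjectiveEnvelope {D : Type*} [Category* D] {A B : D} (f : A ⟶ B) : Prop where
  mono : Mono f
  injective : Injective B
  essential : ∀ {Z : D} (g : B ⟶ Z), Mono (f ≫ g) → Mono g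

section Dualizing

variable (R : Type v) [CommRing R] (C : Type u) [Category.{v} C]

/-- The functor `M ↦ (X ↦ Hom_R(M(X), E))` from functors on `C` to functors on `Cᵒᵖ`. -/
def dualFunctor (E : ModuleCat.{v} R) :
    (C ⥤ ModuleCat.{v} R)ᵒᵖ ⥤ (Cᵒᵖ ⥤ ModuleCat.{v} R) :=
  Functor.opHom C (ModuleCat.{v} R) ⋙
    (Functor.whiskeringRight Cᵒᵖ (ModuleCat.{v} R)ᵒᵖ (ModuleCat.{v} R)).obj
      ((linearYoneda R (ModuleCat.{v} R)).obj E)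

variable [Preadditive C] [Linear R C]

/-- `E` is an injective envelope of `R / rad(R)`, and `Hom_R(-, E)` induces a duality
between `mod(C)` and `mod(Cᵒᵖ)`: it sends `mod(C)` to `mod(Cᵒᵖ)`, and the resulting functor
`mod(C)ᵒᵖ ⥤ mod(Cᵒᵖ)` is an equivalence of categories. -/
def InducesDuality (E : ModuleCat.{v} R) : Prop :=
  (∃ f : ModuleCat.of R (R ⧸ Ring.jacobson R) ⟶ E, IsInjectiveEnvelope f) ∧
  ∃ h : ∀ M : (FPMod R C)ᵒᵖ, IsFinitelyPresented R Cᵒᵖ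
      (((IsFinitelyPresented R C).ι.op ⋙ dualFunctor R C E).obj M),
    ((IsFinitelyPresented R Cᵒᵖ).lift
      ((IsFinitelyPresented R C).ι.op ⋙ dualFunctor R C E) h).IsEquivalence

/-- A dualizing `R`-variety, for an artinian commutative ring `R`: an additive `R`-category in
which idempotents split, which is Hom-finite, and for which the duality `Hom_R(-, E)`, where
`E` is the injective envelope of `R / rad(R)`, induces a duality between `mod(C)` and
`mod(Cᵒᵖ)`. -/
structure IsDualizingVariety : Prop where
  artinian : IsArtinianRing R
  additive : HasFiniteBiproducts C
  idempotents_split : IsIdempotentComplete C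
  hom_finite : ∀ X Y : C, Module.Finite R (X ⟶ Y)
  duality : ∃ E : ModuleCat.{v} R, InducesDuality R C E

end Dualizing

/-! ### The radical of a module and the module `P / rad(P)` -/

section Radical

variable {R : Type v} [CommRing R] {C : Type u} [Category.{v} C]

/-- A submodule (subfunctor) of a `C`-module. -/
@[ext]
structure Submod (M : C ⥤ ModuleCat.{v} R) where
  obj : ∀ X : C, Submodule R (M.obj X)
  map_mem : ∀ {X Y : C} (f : X ⟶ Y) (x : M.obj X), x ∈ obj X → (M.map f).hom x ∈ obj Y

/-- A maximal submodule: a proper submodule such that every submodule containing it is equal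
to it or to the whole module. -/
def Submod.IsMaximal {M : C ⥤ ModuleCat.{v} R} (N : Submod M) : Prop :=
  (∃ X, N.obj X ≠ ⊤) ∧
  ∀ N' : Submod M, (∀ X, N.obj X ≤ N'.obj X) → N' = N ∨ ∀ X, N'.obj X = ⊤

/-- The radical of a `C`-module: the intersection of its maximal submodules. -/
def radical (M : C ⥤ ModuleCat.{v} R) : Submod M where
  obj X := ⨅ (N : Submod M) (_ : N.IsMaximal), N.obj X
  map_mem f x hx := by
    simp only [Submodule.mem_iInf] at hx ⊢
    exact fun N hN => N.map_mem f x (hx N hN)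

/-- The quotient of a `C`-module by a submodule. -/
def Submod.quotient {M : C ⥤ ModuleCat.{v} R} (N : Submod M) : C ⥤ ModuleCat.{v} R where
  obj X := ModuleCat.of R (M.obj X ⧸ N.obj X)
  map {X Y} f := ModuleCat.ofHom
    (Submodule.mapQ (N.obj X) (N.obj Y) (M.map f).hom (fun x hx => N.map_mem f x hx))
  map_id X := by
    ext x
    simp
  map_comp f g := by
    ext x
    simp

end Radical

/-! ### The subcategories `ℙ_k` and `𝕀_k` -/

section Subcategories

variable {R : Type v} [CommRing R] {C : Type u} [Category.{v} C] [Preadditive C] [Linear R C]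

/-- `ℙ_k`, for `0 ≤ k ≤ ∞`: the modules `X` in `mod(C)` with a projective resolution
`⋯ ⟶ Q₁ ⟶ Q₀ ⟶ X ⟶ 0` in `mod(C)` such that `Qₙ ∈ add(P)` for all `n ≤ k`. -/
def projSub (P : FPMod R C) (k : ℕ∞) : ObjectProperty (FPMod R C) := fun X =>
  ∃ (Q : ℕ → FPMod R C) (d : ∀ n, Q (n + 1) ⟶ Q n) (ε : Q 0 ⟶ X),
    (∀ n, Projective (Q n)) ∧
    (∀ Z : C, Function.Surjective (ε.hom.app Z).hom) ∧
    ExactSeq (d 0) ε ∧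
    (∀ n, ExactSeq (d (n + 1)) (d n)) ∧
    ∀ n : ℕ, (n : ℕ∞) ≤ k → IsInAdd P (Q n)

/-- `J` is the injective envelope in `mod(C)` of `P / rad(P)`. -/
def IsEnvelopeOfTop (P J : FPMod R C) : Prop :=
  ∃ (T : FPMod R C) (_ : T.obj ≅ (radical P.obj).quotient) (f : T ⟶ J), IsInjectiveEnvelope f

/-- `𝕀_k`, for `0 ≤ k ≤ ∞`: the modules `Y` in `mod(C)` with an injective coresolution
`0 ⟶ Y ⟶ I₀ ⟶ I₁ ⟶ ⋯` in `mod(C)` such that `Iₙ ∈ add(J)` for all `n ≤ k`, where `J` is the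
injective envelope of `P / rad(P)`. -/
def injSub (P : FPMod R C) (k : ℕ∞) : ObjectProperty (FPMod R C) := fun Y =>
  ∃ J : FPMod R C, IsEnvelopeOfTop P J ∧
  ∃ (I : ℕ → FPMod R C) (d : ∀ n, I n ⟶ I (n + 1)) (η : Y ⟶ I 0),
    (∀ n, Injective (I n)) ∧
    (∀ Z : C, Function.Injective (η.hom.app Z).hom) ∧
    ExactSeq η (d 0) ∧
    (∀ n, ExactSeq (d n) (d (n + 1))) ∧
    ∀ n : ℕ, (n : ℕ∞) ≤ k → IsInAdd J (I n)

/-- The ring `R_P = End(P)ᵒᵖ`.  Here `End P` carries composition of functions as product, so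
that `Hom(P, M)` is a left `R_P`-module by precomposition and `Hom(M, P)` is a left
`End(P)`-module, i.e. a left `R_Pᵒᵖ`-module, by postcomposition. -/
abbrev endRing (P : FPMod R C) : Type (max u v) := (End P)ᵐᵒᵖ

end Subcategories

end DualizingVariety

/-! Both equivalences reduce to one condition on an object, `HasDualBases c`: every left
End(c)-module Hom(c, z) is finitely generated projective, expressed by a finite dual basis. By
Yoneda this is the right-hand side of (b) for `c` in `C`, and that of (a) for `op c` in `Cᵒᵖ`.

For (b), a dual basis of Hom(c, z) writes each element at z of the kernel of a map in add(P) as a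
combination of kernel elements at c (`HasDualBases.kernelGeneratedAt`). By Hom-finiteness the kernel
is then covered by an object of add(P), and a presentation can be prolonged indefinitely.
Conversely, take g : cⁿ ⟶ z through which every map c ⟶ z factors, and u : cᵐ ⟶ cⁿ covering the maps
from c killed by g. The cokernel of Hom(cⁿ, -) ⟶ Hom(cᵐ, -) is in ℙ₁, hence in ℙ_∞, and comparing
resolutions (`kernelGeneratedAt_of_projSub_top`) gives g = ∑ kᵢ ≫ eᵢ with u ≫ kᵢ = 0. The kᵢ induce
the forms dual to the eᵢ.

For (a), the duality turns injective coresolutions into projective resolutions over `Cᵒᵖ`, so (a) is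
(b) for `op c` once add(J) is known to correspond to add(Hom(-, c)) (`exists_isEnvelopeOfTop`).
Finitely many forms separating the points of (P/rad P)(c) embed P/rad P in an injective module dual
to Hom(-, cⁿ), and J is a summand of it. In the other direction, the trace ideal of the dual of J in
End(c) is the whole ring (`isInAdd_rep_of_top`). -/

namespace DualizingVariety

/-! ### Elements of modules, Yoneda maps and quotients -/

section Elements

variable {R : Type v} [CommRing R] {C : Type u} [Category.{v} C] [Preadditive C] [Linear R C]

/-- The component of a morphism of `mod(C)` at an object, as a linear map. -/
def ev {M N : FPMod R C} (f : M ⟶ N) (z : C) : M.obj.obj z →ₗ[R] N.obj.obj z :=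
  (f.hom.app z).hom

/-- The action of a morphism of `C` on a `C`-module, as a linear map. -/
def act (M : FPMod R C) {z w : C} (h : z ⟶ w) : M.obj.obj z →ₗ[R] M.obj.obj w :=
  (M.obj.map h).hom

variable {L M N : FPMod R C} {x y z w : C}

@[simp] theorem ev_id (m : M.obj.obj z) : ev (𝟙 M) z m = m := rfl

@[simp] theorem ev_comp (f : L ⟶ M) (g : M ⟶ N) (m : L.obj.obj z) :
    ev (f ≫ g) z m = ev g z (ev f z m) := rfl

@[simp] theorem ev_zero (m : M.obj.obj z) : ev (0 : M ⟶ N) z m = 0 := rfl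

@[simp] theorem ev_add (f g : M ⟶ N) (m : M.obj.obj z) :
    ev (f + g) z m = ev f z m + ev g z m := rfl

@[simp] theorem ev_sub (f g : M ⟶ N) (m : M.obj.obj z) :
    ev (f - g) z m = ev f z m - ev g z m := rfl

@[simp] theorem ev_sum {ι : Type*} (s : Finset ι) (f : ι → (M ⟶ N)) (m : M.obj.obj z) :
    ev (∑ i ∈ s, f i) z m = ∑ i ∈ s, ev (f i) z m := by
  classical
  induction s using Finset.induction_on with
  | empty => simp
  | insert a s ha ih => rw [Finset.sum_insert ha, Finset.sum_insert ha, ev_add, ih]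

theorem hom_ext {f g : M ⟶ N} (h : ∀ (z : C) (m : M.obj.obj z), ev f z m = ev g z m) : f = g := by
  apply ObjectProperty.hom_ext
  ext z m
  exact h z m

@[simp] theorem act_id (m : M.obj.obj z) : act M (𝟙 z) m = m := by
  simp [act]

@[simp] theorem act_comp (f : x ⟶ y) (g : y ⟶ z) (m : M.obj.obj x) :
    act M (f ≫ g) m = act M g (act M f m) := by
  simp [act]

@[simp] theorem act_add (f g : x ⟶ y) (m : M.obj.obj x) :
    act M (f + g) m = act M f m + act M g m := by
  simp [act, finitelyPresented_map_add M.property]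

@[simp] theorem act_smul (r : R) (f : x ⟶ y) (m : M.obj.obj x) :
    act M (r • f) m = r • act M f m := by
  simp [act, finitelyPresented_map_smul M.property]

@[simp] theorem act_zero (m : M.obj.obj x) : act M (0 : x ⟶ y) m = 0 := by
  simpa using act_smul (M := M) (0 : R) (0 : x ⟶ y) m

@[simp] theorem act_neg (f : x ⟶ y) (m : M.obj.obj x) : act M (-f) m = -act M f m := by
  simpa using act_smul (-1 : R) f m

@[simp] theorem act_sub (f g : x ⟶ y) (m : M.obj.obj x) :
    act M (f - g) m = act M f m - act M g m := by
  simp [sub_eq_add_neg]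

theorem ev_act (f : M ⟶ N) (h : x ⟶ y) (m : M.obj.obj x) :
    ev f y (act M h m) = act N h (ev f x m) :=
  LinearMap.congr_fun (congrArg ModuleCat.Hom.hom (f.hom.naturality h)) m

/-- A morphism `x ⟶ z` as an element of the module `Hom(x, -)`. -/
def el : (x ⟶ z) ≃ₗ[R] (rep R x).obj.obj z := LinearEquiv.refl R (x ⟶ z)

@[simp] theorem act_el (f : x ⟶ y) (h : y ⟶ z) : act (rep R x) h (el f) = el (f ≫ h) := rfl

@[simp] theorem el_symm_act (k : (rep R x).obj.obj y) (h : y ⟶ z) :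
    el.symm (act (rep R x) h k) = el.symm k ≫ h := rfl

/-- A morphism of `mod(C)` given by linear maps compatible with the action of `C`. -/
def mkHom (φ : ∀ z, M.obj.obj z →ₗ[R] N.obj.obj z)
    (hφ : ∀ {z w : C} (h : z ⟶ w) (m : M.obj.obj z), φ w (act M h m) = act N h (φ z m)) :
    M ⟶ N :=
  ObjectProperty.homMk
    { app := fun z => ModuleCat.ofHom (φ z)
      naturality := fun z w h => by
        ext m
        exact hφ h m }

/-- The morphism `Hom(x, -) ⟶ M` corresponding to an element of `M(x)`. -/
def yo (m : M.obj.obj x) : rep R x ⟶ M :=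
  mkHom (fun z =>
    { toFun := fun h => act M (el.symm h) m
      map_add' := fun f g => by simp
      map_smul' := fun r f => by simp }) (fun h f => by simp)

@[simp] theorem ev_yo (m : M.obj.obj x) (k : (rep R x).obj.obj z) :
    ev (yo m) z k = act M (el.symm k) m := rfl

theorem ev_el (f : rep R x ⟶ M) (h : x ⟶ z) : ev f z (el h) = act M h (ev f x (el (𝟙 x))) := by
  rw [← ev_act, act_el, Category.id_comp]

theorem ev_rep (f : rep R x ⟶ M) (k : (rep R x).obj.obj z) :
    ev f z k = act M (el.symm k) (ev f x (el (𝟙 x))) := by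
  rw [← ev_el, LinearEquiv.apply_symm_apply]

theorem yo_ev (f : rep R x ⟶ M) : yo (ev f x (el (𝟙 x))) = f :=
  hom_ext fun z h => by rw [ev_yo, ← ev_rep]

theorem yo_comp (m : M.obj.obj x) (f : M ⟶ N) : yo m ≫ f = yo (ev f x m) :=
  hom_ext fun z h => by simp [ev_act]

/-! ### Cokernels, epimorphisms, monomorphisms -/

/-- `M` is generated by the element `m`. -/
def Generates (m : M.obj.obj x) : Prop :=
  ∀ (z : C) (k : M.obj.obj z), ∃ h : x ⟶ z, act M h m = k

/-- Every object `M` of `mod(C)` has a generator `m` whose relations are generated by a single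
one, `u`. -/
theorem exists_presentation (M : FPMod R C) : ∃ (x y : C) (m : M.obj.obj x) (u : x ⟶ y),
    Generates m ∧ ∀ (z : C) (h : x ⟶ z), act M h m = 0 ↔ ∃ k : y ⟶ z, u ≫ k = h := by
  obtain ⟨C₀, C₁, a, p, hap, hp⟩ := M.property
  let p' : rep R C₁ ⟶ M := ObjectProperty.homMk p
  let a' : rep R C₀ ⟶ rep R C₁ := ObjectProperty.homMk a
  have hap' : ∀ z, Function.Exact (ev a' z) (ev p' z) := hap
  refine ⟨C₁, C₀, ev p' C₁ (el (𝟙 C₁)), el.symm (ev a' C₀ (el (𝟙 C₀))), fun z k => ?_,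
    fun z h => ?_⟩
  · obtain ⟨h, hh⟩ := hp z k
    exact ⟨el.symm h, (ev_rep p' h).symm.trans hh⟩
  · rw [← ev_el]
    refine (hap' z (el h)).trans ⟨?_, ?_⟩
    · rintro ⟨k, hk⟩
      rw [ev_rep] at hk
      exact ⟨el.symm k, by rw [← el_symm_act, hk, LinearEquiv.symm_apply_apply]⟩
    · rintro ⟨k, hk⟩
      refine ⟨el k, (ev_el a' k).trans ?_⟩
      apply el.symm.injective
      rw [el_symm_act, hk, LinearEquiv.symm_apply_apply]

theorem exists_generates (M : FPMod R C) : ∃ (x : C) (m : M.obj.obj x), Generates m := by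
  obtain ⟨x, -, m, -, h, -⟩ := exists_presentation M
  exact ⟨x, m, h⟩

theorem generates_iff {m : M.obj.obj x} :
    Generates m ↔ ∀ z, Function.Surjective (ev (yo m) z) := by
  refine forall_congr' fun z => forall_congr' fun k => ⟨?_, ?_⟩
  · rintro ⟨h, rfl⟩
    exact ⟨el h, by simp⟩
  · rintro ⟨h, rfl⟩
    exact ⟨el.symm h, by simp⟩

theorem isFinitelyPresented_of_generates {F : C ⥤ ModuleCat.{v} R}
    (p : (rep R x).obj ⟶ F) (hp : ∀ z, Function.Surjective (p.app z).hom) (u : x ⟶ y)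
    (hu : ∀ (z : C) (h : x ⟶ z), (p.app z).hom (el h) = 0 ↔ ∃ k : y ⟶ z, u ≫ k = h) :
    IsFinitelyPresented R C F := by
  refine ⟨y, x, (yo (R := R) (el u) : rep R y ⟶ rep R x).hom, p, fun z h => ?_, hp⟩
  refine (hu z h).trans ⟨?_, ?_⟩
  · rintro ⟨k, hk⟩
    exact ⟨el k, hk⟩
  · rintro ⟨k, hk⟩
    exact ⟨el.symm k, hk⟩

/-- The quotient of an object of `mod(C)` by the image of a morphism. -/
theorem exists_quotient [HasFiniteBiproducts C] (f : L ⟶ M) : ∃ (Q : FPMod R C) (q : M ⟶ Q),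
    (∀ z, Function.Surjective (ev q z)) ∧ ∀ z, Function.Exact (ev f z) (ev q z) := by
  obtain ⟨a, l, hl⟩ := exists_generates L
  obtain ⟨b, d, m, u, hm, hu⟩ := exists_presentation M
  obtain ⟨v, hv⟩ := hm a (ev f a l)
  let N : Submod M.obj :=
    { obj := fun z => LinearMap.range (ev f z)
      map_mem := by
        rintro z w h _ ⟨k, rfl⟩
        exact ⟨act L h k, ev_act f h k⟩ }
  let q : M.obj ⟶ N.quotient :=
    { app := fun z => ModuleCat.ofHom (Submodule.mkQ (N.obj z))
      naturality := fun z w h => by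
        ext k
        rfl }
  have hq0 : ∀ z (k : M.obj.obj z), (q.app z).hom k = 0 ↔ ∃ j, ev f z j = k :=
    fun z k => Submodule.Quotient.mk_eq_zero (N.obj z)
  have hqs : ∀ z, Function.Surjective (q.app z).hom := fun z => Submodule.mkQ_surjective _
  have hfp : IsFinitelyPresented R C N.quotient := by
    have := HasBinaryBiproducts.of_hasBinaryProducts (C := C)
    -- The quotient has two kinds of relations: `u`, inherited from `M`, and `v`, which expresses
    -- the image of a generator of `L` through `m`. Biproducts pack both into a single relation.
    refine isFinitelyPresented_of_generates ((yo m).hom ≫ q)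
      (fun z => (hqs z).comp (generates_iff.1 hm z)) (biprod.lift u v) fun z h => ?_
    refine (hq0 z (ev (yo m) z (el h))).trans ?_
    rw [ev_yo, LinearEquiv.symm_apply_apply]
    constructor
    · rintro ⟨j, hj⟩
      obtain ⟨s, rfl⟩ := hl z j
      rw [ev_act, ← hv, ← act_comp, ← sub_eq_zero, ← act_sub, hu] at hj
      obtain ⟨k, hk⟩ := hj
      exact ⟨biprod.desc (-k) s, by simp [hk]⟩
    · rintro ⟨k, rfl⟩
      refine ⟨act L (biprod.inr ≫ k) l, ?_⟩
      have h0 : act M u m = 0 := (hu _ _).2 ⟨𝟙 _, by simp⟩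
      obtain ⟨k₁, k₂, rfl⟩ : ∃ k₁ k₂, k = biprod.desc k₁ k₂ :=
        ⟨biprod.inl ≫ k, biprod.inr ≫ k, by ext <;> simp⟩
      rw [ev_act, ← hv, biprod.inr_desc, biprod.lift_desc, act_add, act_comp, h0, map_zero,
        zero_add, act_comp]
  exact ⟨⟨N.quotient, hfp⟩, ObjectProperty.homMk q, hqs, hq0⟩

end Elements

/-! ### Cokernels, exactness and add(P) in mod(C) -/

section Exactness

variable {R : Type v} [CommRing R] {C : Type u} [Category.{v} C] [Preadditive C] [Linear R C]
variable {L M N : FPMod R C} {x y z w : C}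

theorem exists_desc {q : M ⟶ N} (hq : ∀ z, Function.Surjective (ev q z)) (g : M ⟶ L)
    (h : ∀ z m, ev q z m = 0 → ev g z m = 0) : ∃ g' : N ⟶ L, q ≫ g' = g := by
  have key : ∀ z m, ev g z (Function.surjInv (hq z) (ev q z m)) = ev g z m := fun z m => by
    rw [← sub_eq_zero, ← map_sub]
    exact h z _ (by rw [map_sub, Function.surjInv_eq (hq z), sub_self])
  refine ⟨mkHom (fun z =>
    { toFun := fun n => ev g z (Function.surjInv (hq z) n)
      map_add' := fun a b => ?_
      map_smul' := fun r a => ?_ }) (fun {z w} e n => ?_), hom_ext fun z m => key z m⟩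
  · obtain ⟨a, rfl⟩ := hq z a
    obtain ⟨b, rfl⟩ := hq z b
    rw [← map_add, key, key, key, map_add]
  · obtain ⟨a, rfl⟩ := hq z a
    rw [← map_smul, key, key, map_smul, RingHom.id_apply]
  · obtain ⟨n, rfl⟩ := hq z n
    change ev g w (Function.surjInv (hq w) _) = act L e (ev g z (Function.surjInv (hq z) _))
    rw [← ev_act, key, key, ev_act]

theorem epi_of_surjective {f : M ⟶ N} (hf : ∀ z, Function.Surjective (ev f z)) : Epi f where
  left_cancellation g h e := hom_ext fun z n => by
    obtain ⟨m, rfl⟩ := hf z n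
    rw [← ev_comp, e, ev_comp]

instance hasCokernels [HasFiniteBiproducts C] : HasCokernels (FPMod R C) where
  has_colimit {M N} f := by
    obtain ⟨Q, q, hq, hfq⟩ := exists_quotient f
    have : Epi q := epi_of_surjective hq
    have h0 : f ≫ q = 0 := hom_ext fun z m => (hfq z _).2 ⟨m, rfl⟩
    have hd : ∀ {Z : FPMod R C} (g : N ⟶ Z), f ≫ g = 0 → ∃ g' : Q ⟶ Z, q ≫ g' = g :=
      fun g hg => exists_desc hq g fun z m hm => by
        obtain ⟨k, rfl⟩ := (hfq z m).1 hm
        rw [← ev_comp, hg, ev_zero]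
    exact ⟨⟨_, CokernelCofork.IsColimit.ofπ q h0 (fun g hg => (hd g hg).choose)
      (fun g hg => (hd g hg).choose_spec)
      (fun g hg m hm => by rw [← cancel_epi q, hm, (hd g hg).choose_spec])⟩⟩

/-- The pointwise cokernel stays finitely presented, so an epimorphism has zero pointwise cokernel.
-/
theorem epi_iff_surjective [HasFiniteBiproducts C] {f : M ⟶ N} :
    Epi f ↔ ∀ z, Function.Surjective (ev f z) := by
  refine ⟨fun _ z n => ?_, epi_of_surjective⟩
  obtain ⟨Q, q, hq, hfq⟩ := exists_quotient f
  have : q = 0 := by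
    rw [← cancel_epi f, comp_zero]
    exact hom_ext fun z m => (hfq z _).2 ⟨m, rfl⟩
  exact (hfq z n).1 (by rw [this, ev_zero])

theorem mono_iff_injective {f : M ⟶ N} : Mono f ↔ ∀ z, Function.Injective (ev f z) := by
  constructor
  · intro _ z
    rw [injective_iff_map_eq_zero]
    intro m hm
    have : yo m = 0 := by
      rw [← cancel_mono f, yo_comp, hm, zero_comp]
      exact hom_ext fun z k => by simp
    simpa using congrArg (fun g => ev g z (el (𝟙 z))) this
  · intro hf
    exact ⟨fun g h e => hom_ext fun z m => hf z (by rw [← ev_comp, e, ev_comp])⟩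

theorem exact_kernel_ι [HasKernels (FPMod R C)] (f : M ⟶ N) : ExactSeq (kernel.ι f) f := by
  intro z m
  constructor
  · intro hm
    have hm' : ev f z m = 0 := hm
    have h0 : yo m ≫ f = 0 := by
      rw [yo_comp, hm']
      exact hom_ext fun z k => by simp
    refine ⟨ev (kernel.lift f (yo m) h0) z (el (𝟙 z)), ?_⟩
    change ev (kernel.ι f) z _ = m
    rw [← ev_comp, kernel.lift_ι]
    simp
  · rintro ⟨k, rfl⟩
    change ev f z (ev (kernel.ι f) z k) = 0
    rw [← ev_comp, kernel.condition, ev_zero]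

theorem exactSeq_iff {f : L ⟶ M} {g : M ⟶ N} :
    ExactSeq f g ↔ ∀ z m, ev g z m = 0 ↔ ∃ k, ev f z k = m := Iff.rfl

/-- The kernel of a morphism is covered by a representable module. -/
theorem exists_cover_kernel [HasKernels (FPMod R C)] (f : M ⟶ N) :
    ∃ (x : C) (g : rep R x ⟶ M), ExactSeq g f := by
  obtain ⟨x, m, hm⟩ := exists_generates (kernel f)
  refine ⟨x, yo m ≫ kernel.ι f, exactSeq_iff.2 fun z k => ((exact_kernel_ι f) z k).trans ?_⟩
  constructor
  · rintro ⟨j, hj⟩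
    obtain ⟨i, rfl⟩ := generates_iff.1 hm z j
    exact ⟨i, hj⟩
  · rintro ⟨j, hj⟩
    exact ⟨ev (yo m) z j, hj⟩

instance projective_rep [HasFiniteBiproducts C] (x : C) : Projective (rep R x) where
  factors {E X} f e _ := by
    obtain ⟨m, hm⟩ := epi_iff_surjective.1 ‹Epi e› x (ev f x (el (𝟙 x)))
    exact ⟨yo m, by rw [yo_comp, hm, yo_ev]⟩

theorem IsInAdd.projective {P Q : FPMod R C} (h : IsInAdd P Q) [Projective P] : Projective Q where
  factors {E X} f e _ := by
    obtain ⟨n, s, r, hsr⟩ := h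
    refine ⟨∑ i, s i ≫ Projective.factorThru (r i ≫ f) e, ?_⟩
    rw [Preadditive.sum_comp]
    simp only [Category.assoc, Projective.factorThru_comp]
    simp only [← Category.assoc]
    rw [← Preadditive.sum_comp, hsr, Category.id_comp]

theorem IsInAdd.trans {P Q S : FPMod R C} (h : IsInAdd P Q) (h' : IsInAdd Q S) : IsInAdd P S := by
  obtain ⟨n, s, r, hsr⟩ := h
  obtain ⟨n', s', r', hsr'⟩ := h'
  let e := (finProdFinEquiv (m := n') (n := n)).symm
  refine ⟨n' * n, fun k => s' (e k).1 ≫ s (e k).2, fun k => r (e k).2 ≫ r' (e k).1, ?_⟩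
  rw [e.sum_comp (fun p => (s' p.1 ≫ s p.2) ≫ r p.2 ≫ r' p.1), Fintype.sum_prod_type, ← hsr']
  refine Finset.sum_congr rfl fun i _ => ?_
  have : s' i ≫ (∑ j, s j ≫ r j) ≫ r' i = s' i ≫ r' i := by rw [hsr, Category.id_comp]
  rw [← this]
  simp [Preadditive.comp_sum, Preadditive.sum_comp]

theorem isInAdd_of_retract {P Q S : FPMod R C} (h : IsInAdd P Q) (s : S ⟶ Q) (r : Q ⟶ S)
    (hsr : s ≫ r = 𝟙 S) : IsInAdd P S :=
  h.trans ⟨1, fun _ => s, fun _ => r, by simpa using hsr⟩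

/-- The morphism between representable modules induced by a morphism of `C`. -/
abbrev repMap (a : x ⟶ y) : rep R y ⟶ rep R x := yo (el a)

theorem repMap_comp (a : x ⟶ y) (b : y ⟶ z) :
    repMap (R := R) (a ≫ b) = repMap b ≫ repMap a := by
  rw [yo_comp]
  simp

theorem repMap_id : repMap (R := R) (𝟙 x) = 𝟙 _ := yo_ev (𝟙 (rep R x))

theorem repMap_sum {ι : Type*} (s : Finset ι) (a : ι → (x ⟶ y)) :
    repMap (R := R) (∑ i ∈ s, a i) = ∑ i ∈ s, repMap (a i) :=
  hom_ext fun z k => by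
    simp only [ev_yo, ev_sum, act_el, map_sum]

theorem isInAdd_rep {n : ℕ} (s : Fin n → (x ⟶ y)) (r : Fin n → (y ⟶ x))
    (h : ∑ i, r i ≫ s i = 𝟙 y) : IsInAdd (rep R x) (rep R y) :=
  ⟨n, fun i => repMap (s i), fun i => repMap (r i), by
    simp only [← repMap_comp]
    rw [← repMap_sum, h, repMap_id]⟩

theorem isInAdd_rep_biproduct [HasFiniteBiproducts C] (x : C) (n : ℕ) :
    IsInAdd (rep R x) (rep R (⨁ fun _ : Fin n => x)) :=
  isInAdd_rep (fun i => biproduct.ι (fun _ : Fin n => x) i)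
    (fun i => biproduct.π (fun _ : Fin n => x) i) biproduct.total

/-- The values of a finitely presented module over a Hom-finite category are finite. -/
theorem finite_obj (hf : ∀ X Y : C, Module.Finite R (X ⟶ Y)) (M : FPMod R C) (z : C) :
    Module.Finite R (M.obj.obj z) := by
  obtain ⟨x, m, hm⟩ := exists_generates M
  have : Module.Finite R ((rep R x).obj.obj z) := hf x z
  exact Module.Finite.of_surjective (ev (yo m) z) (generates_iff.1 hm z)

end Exactness

/-! ### Resolutions by add(P) and dual bases -/

section Resolutions

variable {R : Type v} [CommRing R] {C : Type u} [Category.{v} C] [Preadditive C] [Linear R C]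
variable {A B D L M N : FPMod R C} {x y z w : C}

/-- For every object `z`, the `End(c)`-module `Hom(c, z)` has a finite dual basis. -/
def HasDualBases (c : C) : Prop :=
  ∀ z : C, ∃ (l : ℕ) (h : Fin l → (c ⟶ z)) (φ : Fin l → (c ⟶ z) →+ (c ⟶ c)),
    (∀ i (a : c ⟶ c) g, φ i (a ≫ g) = a ≫ φ i g) ∧ ∀ g, ∑ i, φ i g ≫ h i = g

/-- The kernel of `f` is generated, as a `C`-module, by its value at `c`. -/
def KernelGeneratedAt (c : C) (f : A ⟶ B) : Prop :=
  ∀ (z : C) (k : A.obj.obj z), ev f z k = 0 →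
    ∃ (n : ℕ) (h : Fin n → (c ⟶ z)) (k' : Fin n → A.obj.obj c),
      (∀ i, ev f c (k' i) = 0) ∧ ∑ i, act A (h i) (k' i) = k

/-- In coordinates, `k` is a tuple of maps c ⟶ z and `f` is a matrix over End(c). Applying each
linear form `φ i` to the tuple preserves the relations defining the kernel, and the dual basis
identity reassembles `k`. -/
theorem HasDualBases.kernelGeneratedAt {c : C} (hc : HasDualBases c) (f : A ⟶ B)
    (hA : IsInAdd (rep R c) A) (hB : IsInAdd (rep R c) B) : KernelGeneratedAt c f := by
  obtain ⟨n, s, r, hsr⟩ := hA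
  obtain ⟨n', s', r', hsr'⟩ := hB
  intro z k hk
  obtain ⟨l, h, φ, hφ, hφh⟩ := hc z
  have hA' : ∀ {z : C} (k : A.obj.obj z), ∑ j, ev (r j) z (ev (s j) z k) = k := fun k => by
    simpa using congrArg (fun g => ev g _ k) hsr
  have hB' : ∀ {z : C} (k : B.obj.obj z), ∑ j, ev (r' j) z (ev (s' j) z k) = k := fun k => by
    simpa using congrArg (fun g => ev g _ k) hsr'
  refine ⟨l, h, fun i => ∑ j, ev (r j) c (el (φ i (el.symm (ev (s j) z k)))), fun i => ?_, ?_⟩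
  · have key : ∀ t, ev (s' t) c
        (ev f c (∑ j, ev (r j) c (el (φ i (el.symm (ev (s j) z k)))))) = 0 := by
      intro t
      -- The matrix entries of `f` into the coordinate `t`.
      let m : Fin n → (c ⟶ c) := fun j => el.symm (ev (r j ≫ f ≫ s' t) c (el (𝟙 c)))
      have hm : ∀ (z : C) (j) (g : (rep R c).obj.obj z),
          ev (s' t) z (ev f z (ev (r j) z g)) = el (m j ≫ el.symm g) := fun z j g => by
        have := ev_rep (r j ≫ f ≫ s' t) g
        rw [ev_comp, ev_comp] at this
        rw [this]
        apply el.symm.injective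
        rw [el_symm_act, LinearEquiv.symm_apply_apply]
      have h1 : ∑ j, m j ≫ el.symm (ev (s j) z k) = 0 := by
        apply (el (R := R)).injective
        rw [map_sum, map_zero]
        simp only [← hm]
        rw [← map_sum, ← map_sum, hA', hk, map_zero]
      rw [map_sum, map_sum]
      simp only [hm, LinearEquiv.symm_apply_apply, ← hφ]
      rw [← map_sum, ← map_sum, h1, map_zero, map_zero]
    rw [← hB' (ev f c _)]
    simp only [key, map_zero, Finset.sum_const_zero]
  · conv_rhs => rw [← hA' k]
    simp only [map_sum, ← ev_act, act_el]
    rw [Finset.sum_comm]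
    refine Finset.sum_congr rfl fun j _ => ?_
    rw [← map_sum, ← map_sum, hφh, LinearEquiv.apply_symm_apply]

/-- The kernel at c is a finitely generated R-module; n generators amount to one element of A(cⁿ),
hence to a map from Hom(cⁿ, -). -/
theorem KernelGeneratedAt.exists_cover [HasFiniteBiproducts C] [IsNoetherianRing R]
    (hf : ∀ X Y : C, Module.Finite R (X ⟶ Y)) {c : C} {f : A ⟶ B}
    (h : KernelGeneratedAt c f) :
    ∃ (A' : FPMod R C) (g : A' ⟶ A), IsInAdd (rep R c) A' ∧ ExactSeq g f := by
  have := finite_obj hf A c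
  obtain ⟨n, k, hk⟩ := Submodule.fg_iff_exists_fin_generating_family.1
    (IsNoetherian.noetherian (LinearMap.ker (ev f c)))
  have hk0 : ∀ i, ev f c (k i) = 0 := fun i => by
    have : k i ∈ LinearMap.ker (ev f c) := hk ▸ Submodule.subset_span ⟨i, rfl⟩
    exact this
  let d := ⨁ fun _ : Fin n => c
  let Y : A.obj.obj d := ∑ i, act A (biproduct.ι (fun _ : Fin n => c) i) (k i)
  refine ⟨rep R d, yo Y, isInAdd_rep_biproduct c n, exactSeq_iff.2 fun z m => ⟨fun hm => ?_, ?_⟩⟩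
  · change m ∈ LinearMap.range (ev (yo Y) z)
    obtain ⟨n', h', k', hk', rfl⟩ := h z m hm
    refine Submodule.sum_mem _ fun j _ => ?_
    have h1 : LinearMap.ker (ev f c) ≤
        (LinearMap.range (ev (yo Y) z)).comap (act A (h' j)) := by
      rw [← hk, Submodule.span_le]
      rintro _ ⟨i, rfl⟩
      refine ⟨el (biproduct.π (fun _ : Fin n => c) i ≫ h' j), ?_⟩
      simp only [ev_yo, LinearEquiv.symm_apply_apply, Y, act_comp]
      rw [map_sum]
      simp only [← act_comp]
      rw [Finset.sum_eq_single i]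
      · simp
      · intro t _ ht
        simp [ht]
      · simp
    exact h1 (hk' j)
  · rintro ⟨e, rfl⟩
    simp [Y, ev_act, hk0]

/-- An inductive construction of sequences of composable morphisms. -/
theorem exists_sequence {V : Type*} [Category* V] (I : ∀ {A B : V}, ℕ → (A ⟶ B) → Prop)
    (E : ∀ {A B D : V}, (A ⟶ B) → (B ⟶ D) → Prop)
    (step : ∀ {A B : V} (n : ℕ) (f : A ⟶ B), I n f → ∃ (A' : V) (g : A' ⟶ A), I (n + 1) g ∧ E g f)
    {A X : V} (f : A ⟶ X) (hf : I 0 f) :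
    ∃ (Q : ℕ → V) (d : ∀ n, Q (n + 1) ⟶ Q n) (ε : Q 0 ⟶ X),
      I 0 ε ∧ E (d 0) ε ∧ (∀ n, E (d (n + 1)) (d n)) ∧ ∀ n, I (n + 1) (d n) := by
  choose! A' g hg using @step
  let T : ℕ → Type _ := fun n => {p : Σ A B : V, (A ⟶ B) // I n p.2.2}
  let seq : ∀ n, T n := fun n => Nat.rec (motive := T) ⟨⟨A, X, f⟩, hf⟩
    (fun n p => ⟨⟨A' n p.1.2.2, p.1.1, g n p.1.2.2 p.2⟩, (hg n _ p.2).1⟩) n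
  exact ⟨fun n => (seq n).1.1, fun n => (seq (n + 1)).1.2.2, (seq 0).1.2.2, hf,
    (hg 0 _ hf).2, fun n => (hg (n + 1) _ (seq (n + 1)).2).2, fun n => (seq (n + 1)).2⟩

theorem projSub_one_iff [HasFiniteBiproducts C] [HasKernels (FPMod R C)] {c : C}
    {X : FPMod R C} : projSub (rep R c) 1 X ↔
      ∃ (A B : FPMod R C) (g : B ⟶ A) (ε : A ⟶ X), IsInAdd (rep R c) A ∧ IsInAdd (rep R c) B ∧
        (∀ z, Function.Surjective (ev ε z)) ∧ ExactSeq g ε := by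
  constructor
  · rintro ⟨Q, d, ε, -, hε, h0, -, hk⟩
    exact ⟨Q 0, Q 1, d 0, ε, hk 0 (by simp), hk 1 (by simp), hε, h0⟩
  · rintro ⟨A, B, g, ε, hA, hB, hε, hg⟩
    -- Index 0 stands for ε and index n + 1 for `d n`, so indices 0 and 1 control `Q 0` and `Q 1`.
    -- Beyond that only projectivity is needed.
    let I : ∀ {A B : FPMod R C}, ℕ → (A ⟶ B) → Prop := fun {A B} n f => match n with
      | 0 => (∀ z, Function.Surjective (ev f z)) ∧ IsInAdd (rep R c) A ∧
          ∃ (A' : FPMod R C) (g : A' ⟶ A), IsInAdd (rep R c) A' ∧ ExactSeq g f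
      | 1 => IsInAdd (rep R c) A
      | _ + 2 => Projective A
    obtain ⟨Q, d, ε, hε, h0, hd, hI⟩ := exists_sequence (V := FPMod R C) I ExactSeq
      (fun {A B} n f hf => by
        match n with
        | 0 => exact hf.2.2
        | n + 1 =>
          obtain ⟨x, g, hg⟩ := exists_cover_kernel f
          exact ⟨_, g, projective_rep x, hg⟩) ε ⟨hε, hA, B, g, hB, hg⟩
    refine ⟨Q, d, ε, fun n => ?_, hε.1, h0, hd, fun n hn => ?_⟩
    · match n with
      | 0 => exact hε.2.1.projective
      | 1 => exact IsInAdd.projective (hI 0)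
      | n + 2 => exact hI (n + 1)
    · have hn : n ≤ 1 := by exact_mod_cast hn
      match n with
      | 0 => exact hε.2.1
      | 1 => exact hI 0

theorem projSub_top_of_hasDualBases [HasFiniteBiproducts C] [IsNoetherianRing R]
    (hf : ∀ X Y : C, Module.Finite R (X ⟶ Y)) {c : C} (hc : HasDualBases c)
    {X : FPMod R C} (hX : projSub (rep R c) 1 X) : projSub (rep R c) ⊤ X := by
  obtain ⟨Q, d, ε, -, hε, h0, -, hk⟩ := hX
  let I : ∀ {A B : FPMod R C}, ℕ → (A ⟶ B) → Prop := fun {A B} n f =>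
    (n = 0 → ∀ z, Function.Surjective (ev f z)) ∧ IsInAdd (rep R c) A ∧
      ∃ (A' : FPMod R C) (g : A' ⟶ A), IsInAdd (rep R c) A' ∧ ExactSeq g f
  obtain ⟨Q, d, ε, hε, h0, hd, hI⟩ := exists_sequence (V := FPMod R C) I ExactSeq
    (fun {A B} n f hfI => by
      obtain ⟨-, hA, A', g, hA', hg⟩ := hfI
      exact ⟨A', g, ⟨fun h => by simp at h, hA', (hc.kernelGeneratedAt g hA' hA).exists_cover hf⟩,
        hg⟩)
    ε ⟨fun _ => hε, hk 0 (by simp), Q 1, d 0, hk 1 (by simp), h0⟩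
  have hadd : ∀ n, IsInAdd (rep R c) (Q n) := fun n => match n with
    | 0 => hε.2.1
    | n + 1 => (hI n).2.1
  exact ⟨Q, d, ε, fun n => (hadd n).projective, hε.1 rfl, h0, hd, fun n _ => hadd n⟩

/-- A morphism from a projective object lifts along an exact sequence. -/
theorem exists_lift_of_exactSeq [HasFiniteBiproducts C] [HasKernels (FPMod R C)]
    {P : FPMod R C} [Projective P] {f : A ⟶ B} {g : B ⟶ D} (h : ExactSeq f g) (k : P ⟶ B)
    (hk : k ≫ g = 0) : ∃ k' : P ⟶ A, k' ≫ f = k := by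
  have h0 : f ≫ g = 0 := hom_ext fun z m => (h z _).2 ⟨m, rfl⟩
  have : Epi (kernel.lift g f h0) := epi_of_surjective fun z m => by
    have hm : ev g z (ev (kernel.ι g) z m) = 0 := by
      rw [← ev_comp, kernel.condition, ev_zero]
    obtain ⟨a, ha⟩ := (h z _).1 hm
    refine ⟨a, mono_iff_injective.1 (inferInstance : Mono (kernel.ι g)) z ?_⟩
    rw [← ev_comp, kernel.lift_ι]
    exact ha
  refine ⟨Projective.factorThru (kernel.lift g k hk) (kernel.lift g f h0), ?_⟩
  calc _ = (Projective.factorThru (kernel.lift g k hk) (kernel.lift g f h0) ≫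
        kernel.lift g f h0) ≫ kernel.ι g := by rw [Category.assoc, kernel.lift_ι]
    _ = k := by rw [Projective.factorThru_comp, kernel.lift_ι]

theorem generated_of_isInAdd {c : C} (hA : IsInAdd (rep R c) A) (k : A.obj.obj z) :
    ∃ (n : ℕ) (h : Fin n → (c ⟶ z)) (k' : Fin n → A.obj.obj c), ∑ i, act A (h i) (k' i) = k := by
  obtain ⟨n, s, r, hsr⟩ := hA
  refine ⟨n, fun i => el.symm (ev (s i) z k), fun i => ev (r i) c (el (𝟙 c)), ?_⟩
  simp only [← ev_rep]
  simpa using congrArg (fun g => ev g _ k) hsr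

/-- If `X` has a resolution by objects of `add(Hom(c, -))`, then the kernel of any presentation
of `X` by such objects is generated at `c`. -/
theorem kernelGeneratedAt_of_projSub_top [HasFiniteBiproducts C] [HasKernels (FPMod R C)] {c : C}
    {X : FPMod R C} (hX : projSub (rep R c) ⊤ X) {g : B ⟶ A} {ε : A ⟶ X}
    (hA : IsInAdd (rep R c) A) (hB : IsInAdd (rep R c) B)
    (hε : ∀ z, Function.Surjective (ev ε z)) (hg : ExactSeq g ε) : KernelGeneratedAt c g := by
  obtain ⟨Q, d, η, hQ, hη, h0, hd, hk⟩ := hX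
  have hE : Epi ε := epi_of_surjective hε
  have hE' : Epi η := epi_of_surjective hη
  have hPA := hA.projective
  have hPB := hB.projective
  have w : g ≫ ε = 0 := hom_ext fun z m => (hg z _).2 ⟨m, rfl⟩
  have w0 : d 0 ≫ η = 0 := hom_ext fun z m => (h0 z _).2 ⟨m, rfl⟩
  have w1 : d 1 ≫ d 0 = 0 := hom_ext fun z m => (hd 0 z _).2 ⟨m, rfl⟩
  let f₀ : A ⟶ Q 0 := Projective.factorThru ε η
  have hf₀ : f₀ ≫ η = ε := Projective.factorThru_comp _ _
  let b₀ : Q 0 ⟶ A := Projective.factorThru η ε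
  have hb₀ : b₀ ≫ ε = η := Projective.factorThru_comp _ _
  obtain ⟨f₁, hf₁⟩ := exists_lift_of_exactSeq h0 (g ≫ f₀) (by rw [Category.assoc, hf₀, w])
  obtain ⟨b₁, hb₁⟩ := exists_lift_of_exactSeq hg (d 0 ≫ b₀) (by rw [Category.assoc, hb₀, w0])
  obtain ⟨s, hs⟩ := exists_lift_of_exactSeq hg (𝟙 A - f₀ ≫ b₀) (by
    rw [Preadditive.sub_comp, Category.assoc, hb₀, hf₀, Category.id_comp, sub_self])
  -- The homotopy `s` corrects `𝟙 B - f₁ ≫ b₁` so that it lands in ker g. On ker g the correction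
  -- vanishes, so k is the sum of its images under `f₁ ≫ b₁` and `ψ`; the first comes from `Q 2`,
  -- the second from `B`, both generated at c.
  let ψ : B ⟶ B := 𝟙 B - f₁ ≫ b₁ - g ≫ s
  have hψ : ψ ≫ g = 0 := by
    simp only [ψ, Preadditive.sub_comp, Category.assoc, hs, hb₁, Category.id_comp,
      Preadditive.comp_sub, Category.comp_id]
    rw [← Category.assoc, hf₁, Category.assoc, sub_self]
  intro z k hk0
  have h1 : ev (d 0) z (ev f₁ z k) = 0 := by
    rw [← ev_comp, hf₁, ev_comp, hk0, map_zero]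
  obtain ⟨q, hq⟩ := (hd 0 z _).1 h1
  have hq' : ev (d 1) z q = ev f₁ z k := hq
  obtain ⟨n, e, q', hqe⟩ := generated_of_isInAdd (hk 2 (by simp)) q
  obtain ⟨n', e', k', hke⟩ := generated_of_isInAdd hB k
  have hsum : k = ev b₁ z (ev (d 1) z q) + ev ψ z k := by
    rw [hq']
    simp [ψ, hk0]
  refine ⟨n + n', Fin.append e e',
    Fin.append (fun i => ev (d 1 ≫ b₁) c (q' i)) (fun i => ev ψ c (k' i)), fun i => ?_, ?_⟩
  · induction i using Fin.addCases with
    | left i =>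
      rw [Fin.append_left, ← ev_comp, Category.assoc, hb₁, ← Category.assoc, w1, zero_comp,
        ev_zero]
    | right i => rw [Fin.append_right, ← ev_comp, hψ, ev_zero]
  · rw [Fin.sum_univ_add]
    simp only [Fin.append_left, Fin.append_right, ← ev_act]
    rw [← map_sum, ← map_sum, hqe, hke]
    exact hsum.symm

theorem hasDualBases_of_projSub_eq [HasFiniteBiproducts C] [HasKernels (FPMod R C)]
    [IsNoetherianRing R] (hf : ∀ X Y : C, Module.Finite R (X ⟶ Y)) {c : C}
    (h : ∀ X : FPMod R C, projSub (rep R c) 1 X → projSub (rep R c) ⊤ X) : HasDualBases c := by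
  intro z
  have := hf
  obtain ⟨n, x, hx⟩ := Module.Finite.exists_fin (R := R) (M := (c ⟶ z))
  let d := ⨁ fun _ : Fin n => c
  let g : d ⟶ z := biproduct.desc x
  have hgs : Function.Surjective (Linear.rightComp R c g) := by
    rw [← LinearMap.range_eq_top, ← top_le_iff, ← hx, Submodule.span_le]
    rintro _ ⟨i, rfl⟩
    exact ⟨biproduct.ι (fun _ : Fin n => c) i, by simp [g]⟩
  obtain ⟨m, v, hv⟩ := Submodule.fg_iff_exists_fin_generating_family.1
    (IsNoetherian.noetherian (LinearMap.ker (Linear.rightComp R c g)))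
  let d' := ⨁ fun _ : Fin m => c
  let u : d' ⟶ d := biproduct.desc v
  have hug : u ≫ g = 0 := by
    ext i
    have : v i ∈ LinearMap.ker (Linear.rightComp R c g) := hv ▸ Submodule.subset_span ⟨i, rfl⟩
    simpa [u] using this
  -- Yoneda reverses `u`, so `X` is presented by two objects of add(Hom(c, -)), and `u ≫ g = 0` says
  -- that `g` is an element at `z` of the kernel of the presentation.
  obtain ⟨X, ε, hε, hex⟩ := exists_quotient (repMap (R := R) u)
  have hd := isInAdd_rep_biproduct (R := R) c n
  have hd' := isInAdd_rep_biproduct (R := R) c m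
  have hX := h X (projSub_one_iff.2 ⟨_, _, repMap u, ε, hd', hd, hε, hex⟩)
  obtain ⟨l, e, k, hk, hke⟩ := kernelGeneratedAt_of_projSub_top hX hd' hd hε hex z (el g)
    (by simp [hug])
  -- The maps c ⟶ d killed by `g` are spanned by the components of `u`, and `u` kills `k i`. Hence
  -- `w ≫ k i` depends only on `w ≫ g`, and composing any preimage of y with `k i` gives a
  -- well-defined linear form.
  have hk' : ∀ i (w : c ⟶ d), w ≫ g = 0 → w ≫ el.symm (k i) = 0 := by
    intro i
    have hu : u ≫ el.symm (k i) = 0 := by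
      apply (el (R := R)).injective
      simpa using hk i
    have : LinearMap.ker (Linear.rightComp R c g) ≤
        LinearMap.ker (Linear.rightComp R c (el.symm (k i))) := by
      rw [← hv, Submodule.span_le]
      rintro _ ⟨j, rfl⟩
      change v j ≫ _ = 0
      have : v j = biproduct.ι (fun _ : Fin m => c) j ≫ u := by simp [u]
      rw [this, Category.assoc, hu, comp_zero]
    exact fun w hw => this hw
  have hk2 : ∀ i (w w' : c ⟶ d), w ≫ g = w' ≫ g → w ≫ el.symm (k i) = w' ≫ el.symm (k i) := by
    intro i w w' hw
    rw [← sub_eq_zero, ← Preadditive.sub_comp]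
    exact hk' i _ (by rw [Preadditive.sub_comp, hw, sub_self])
  have hs : ∀ y : c ⟶ z, Function.surjInv hgs y ≫ g = y := Function.surjInv_eq hgs
  refine ⟨l, e, fun i => AddMonoidHom.mk' (fun y => Function.surjInv hgs y ≫ el.symm (k i))
    (fun a b => ?_), fun i a y => ?_, fun y => ?_⟩
  · rw [← Preadditive.add_comp]
    exact hk2 i _ _ (by rw [Preadditive.add_comp, hs, hs, hs])
  · change _ = a ≫ Function.surjInv hgs y ≫ el.symm (k i)
    rw [← Category.assoc]
    exact hk2 i _ _ (by rw [Category.assoc, hs, hs])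
  · change ∑ i, (Function.surjInv hgs y ≫ el.symm (k i)) ≫ e i = y
    simp only [Category.assoc]
    rw [← Preadditive.comp_sum]
    have : ∑ i, el.symm (k i) ≫ e i = g := by
      have := congrArg el.symm hke
      simpa [map_sum] using this
    rw [this, hs]

theorem projSub_eq_iff_hasDualBases [HasFiniteBiproducts C] [HasKernels (FPMod R C)]
    [IsNoetherianRing R] (hf : ∀ X Y : C, Module.Finite R (X ⟶ Y)) {c : C} :
    (∀ X : FPMod R C, projSub (rep R c) 1 X → projSub (rep R c) ⊤ X) ↔ HasDualBases c :=
  ⟨hasDualBases_of_projSub_eq hf, fun h _ => projSub_top_of_hasDualBases hf h⟩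

end Resolutions

/-! ### Dual bases versus projectivity over End(P) and its opposite -/

/-- The dual basis criterion for projectivity of a finitely generated module, transported along
isomorphisms of additive groups. -/
theorem projective_iff_exists_dualBasis {A N Λ X : Type*} [Ring A] [AddCommGroup N] [Module A N]
    [AddCommGroup Λ] [AddCommGroup X] (eA : Λ ≃+ A) (eN : X ≃+ N) (mu : Λ → Λ → Λ)
    (sm : Λ → X → X) (hmu : ∀ a b, eA (mu a b) = eA a * eA b)
    (hsm : ∀ a x, eN (sm a x) = eA a • eN x)
    (hfin : ∃ (l : ℕ) (h : Fin l → X), ∀ x, ∃ b : Fin l → Λ, ∑ i, sm (b i) (h i) = x) :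
    Module.Projective A N ↔ ∃ (l : ℕ) (h : Fin l → X) (φ : Fin l → X →+ Λ),
      (∀ i a x, φ i (sm a x) = mu a (φ i x)) ∧ ∀ x, ∑ i, sm (φ i x) (h i) = x := by
  constructor
  · intro _
    obtain ⟨l, h, hh⟩ := hfin
    let p := Fintype.linearCombination A (fun i => eN (h i))
    have hp : Function.Surjective p := fun n => by
      obtain ⟨b, hb⟩ := hh (eN.symm n)
      refine ⟨fun i => eA (b i), ?_⟩
      rw [Fintype.linearCombination_apply]
      simp only [← hsm]
      rw [← map_sum, hb, AddEquiv.apply_symm_apply]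
    obtain ⟨s, hs⟩ := Module.projective_lifting_property p LinearMap.id hp
    refine ⟨l, h, fun i => AddMonoidHom.mk' (fun x => eA.symm (s (eN x) i)) (fun x y => by simp),
      fun i a x => ?_, fun x => ?_⟩
    · apply eA.injective
      simp [hsm, hmu]
    · apply eN.injective
      rw [map_sum]
      simp only [hsm, AddMonoidHom.mk'_apply, AddEquiv.apply_symm_apply]
      have := LinearMap.congr_fun hs (eN x)
      rwa [LinearMap.comp_apply, Fintype.linearCombination_apply] at this
  · rintro ⟨l, h, φ, hφ, hx⟩
    let s : N →ₗ[A] (Fin l → A) :=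
      { toFun := fun n i => eA (φ i (eN.symm n))
        map_add' := fun x y => by
          ext i
          simp
        map_smul' := fun a n => by
          ext i
          obtain ⟨a, rfl⟩ := eA.surjective a
          obtain ⟨n, rfl⟩ := eN.surjective n
          simp [← hsm, ← hmu, hφ] }
    refine Module.Projective.of_split s (Fintype.linearCombination A (fun i => eN (h i))) ?_
    ext n
    obtain ⟨n, rfl⟩ := eN.surjective n
    simp [Fintype.linearCombination_apply, s, ← hsm, ← map_sum, hx]

section Yoneda

variable {R : Type v} [CommRing R] {C : Type u} [Category.{v} C] [Preadditive C] [Linear R C]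

/-- The Yoneda isomorphism between morphisms of `C` and morphisms of representable modules. -/
def repMapEquiv (x y : C) : (x ⟶ y) ≃+ (rep R y ⟶ rep R x) where
  toFun a := repMap a
  invFun f := el.symm (ev f y (el (𝟙 y)))
  left_inv a := by simp
  right_inv f := yo_ev f
  map_add' a b := hom_ext fun z k => by simp

theorem exists_generators (hf : ∀ X Y : C, Module.Finite R (X ⟶ Y)) (c z : C) :
    ∃ (l : ℕ) (h : Fin l → (c ⟶ z)), ∀ g, ∃ b : Fin l → (c ⟶ c), ∑ i, b i ≫ h i = g := by
  have := hf
  obtain ⟨l, h, hh⟩ := Module.Finite.exists_fin (R := R) (M := (c ⟶ z))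
  refine ⟨l, h, fun g => ?_⟩
  have hg : g ∈ Submodule.span R (Set.range h) := hh ▸ Submodule.mem_top
  obtain ⟨r, hr⟩ := (Submodule.mem_span_range_iff_exists_fun R).1 hg
  exact ⟨fun i => r i • 𝟙 c, by simpa using hr⟩

theorem hasDualBases_iff_projective (hf : ∀ X Y : C, Module.Finite R (X ⟶ Y)) (c : C) :
    HasDualBases c ↔ ∀ z : C, Module.Projective (End (rep R c)) (rep R z ⟶ rep R c) := by
  refine forall_congr' fun z => (projective_iff_exists_dualBasis
    (A := End (rep R c)) (N := rep R z ⟶ rep R c) (repMapEquiv c c) (repMapEquiv c z)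
    (fun a b => a ≫ b) (fun a g => a ≫ g) (fun a b => repMap_comp a b)
    (fun a g => repMap_comp a g) (exists_generators hf c z)).symm

theorem finite_hom_op (hf : ∀ X Y : C, Module.Finite R (X ⟶ Y)) (X Y : Cᵒᵖ) :
    Module.Finite R (X ⟶ Y) :=
  have := hf Y.unop X.unop
  Module.Finite.of_surjective
    ({ toFun := fun f => f.op, map_add' := fun _ _ => rfl, map_smul' := fun _ _ => rfl } :
      (Y.unop ⟶ X.unop) →ₗ[R] (X ⟶ Y)) fun f => ⟨f.unop, rfl⟩

/-- Morphisms `x ⟶ y` of the opposite category as morphisms between representable modules. -/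
def repMapOpEquiv (x y : C) : (op x ⟶ op y) ≃+ (rep R x ⟶ rep R y) :=
  AddEquiv.trans { opEquiv (op x) (op y) with map_add' := fun _ _ => rfl } (repMapEquiv y x)

/-- Maps `op c ⟶ op z` are maps z ⟶ c, that is, maps from Hom(c, -) to Hom(z, -). The extra reversal
puts the action over the opposite of End(P). -/
theorem hasDualBases_op_iff_projective (hf : ∀ X Y : C, Module.Finite R (X ⟶ Y)) (c : C) :
    HasDualBases (op c) ↔ ∀ z : C, Module.Projective (endRing (rep R c)) (rep R c ⟶ rep R z) := by
  refine Opposite.op_surjective.forall.trans (forall_congr' fun z =>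
    (projective_iff_exists_dualBasis (A := endRing (rep R c)) (N := rep R c ⟶ rep R z)
      ((repMapOpEquiv c c).trans MulOpposite.opAddEquiv) (repMapOpEquiv c z)
      (fun a b => a ≫ b) (fun a g => a ≫ g) (fun a b => ?_)
      (fun a g => ?_) (exists_generators (finite_hom_op hf) (op c) (op z))).symm)
  · exact congrArg MulOpposite.op (repMap_comp b.unop a.unop)
  · exact repMap_comp g.unop a.unop

end Yoneda

/-! ### Injective cogenerators over an artinian ring -/

section Cogenerator

variable {R : Type v} [CommRing R]

/-- `E` is an injective cogenerator of the category of `R`-modules. -/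
structure IsInjectiveCogenerator (E : ModuleCat.{v} R) : Prop where
  injective : Injective E
  exists_ne_zero : ∀ (N : Type v) [AddCommGroup N] [Module R N] (x : N), x ≠ 0 →
    ∃ φ : N →ₗ[R] E, φ x ≠ 0

variable {E : ModuleCat.{v} R} {L M N : Type v} [AddCommGroup L] [AddCommGroup M] [AddCommGroup N]
  [Module R L] [Module R M] [Module R N]

theorem exists_extension [Injective E] {f : M →ₗ[R] N} (hf : Function.Injective f)
    (φ : M →ₗ[R] E) : ∃ ψ : N →ₗ[R] E, ψ ∘ₗ f = φ := by
  have : Mono (ModuleCat.ofHom f) := (ModuleCat.mono_iff_injective _).2 hf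
  refine ⟨(Injective.factorThru (ModuleCat.ofHom φ) (ModuleCat.ofHom f)).hom, ?_⟩
  exact congrArg ModuleCat.Hom.hom
    (Injective.comp_factorThru (ModuleCat.ofHom φ) (ModuleCat.ofHom f))

theorem exists_extension_of_ker_le [Injective E] {f : M →ₗ[R] N} {φ : M →ₗ[R] E}
    (h : LinearMap.ker f ≤ LinearMap.ker φ) : ∃ ψ : N →ₗ[R] E, ψ ∘ₗ f = φ := by
  obtain ⟨ψ, hψ⟩ := exists_extension (E := E) (f := (LinearMap.ker f).liftQ f le_rfl)
    (LinearMap.ker_eq_bot.1 (Submodule.ker_liftQ_eq_bot _ _ _ le_rfl))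
    ((LinearMap.ker f).liftQ φ h)
  refine ⟨ψ, ?_⟩
  ext m
  simpa using LinearMap.congr_fun hψ (Submodule.Quotient.mk m)

/-- For `R` artinian, an injective module containing `R / rad(R)` is a cogenerator. -/
theorem isInjectiveCogenerator_of_mono [IsArtinianRing R] [Injective E]
    (j : ModuleCat.of R (R ⧸ Ring.jacobson R) ⟶ E) [Mono j] : IsInjectiveCogenerator E := by
  refine ⟨inferInstance, fun N _ _ x hx => ?_⟩
  have hj : Function.Injective j.hom := (ModuleCat.mono_iff_injective j).1 inferInstance
  let I : Ideal R := LinearMap.ker (LinearMap.toSpanSingleton R N x)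
  have hI : I ≠ ⊤ := fun h => hx (by
    have h1 : (1 : R) ∈ I := h ▸ Submodule.mem_top
    simpa [I] using h1)
  obtain ⟨m, hm, hIm⟩ := Ideal.exists_le_maximal I hI
  -- There are finitely many maximal ideals, so some r lies in all of them except m. Then 1 ↦ r
  -- modulo rad(R) kills m, which contains the annihilator of x, and so defines a nonzero form on R
  -- x.
  obtain ⟨r, hr, hrm⟩ : ∃ r, r ∉ m ∧ ∀ s ∈ m, r * s ∈ Ring.jacobson R := by
    classical
    have hfin : {I : Ideal R | I.IsMaximal}.Finite := IsArtinianRing.setOfPred_isMaximal_finite R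
    let S : Finset (Ideal R) := hfin.toFinset.erase m
    have hS : ¬ S.inf id ≤ m := by
      intro hle
      obtain ⟨m', hm', hle'⟩ := (Ideal.IsPrime.inf_le' hm.isPrime).1 hle
      obtain ⟨hne, hm'⟩ := Finset.mem_erase.1 hm'
      have : m'.IsMaximal := hfin.mem_toFinset.1 hm'
      exact hne (this.eq_of_le hm.ne_top hle')
    obtain ⟨r, hr, hrm⟩ := Set.not_subset.1 hS
    refine ⟨r, hrm, fun s hs => ?_⟩
    rw [Ring.jacobson_eq_sInf_isMaximal, Submodule.mem_sInf]
    intro m' hm'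
    by_cases hmm : m' = m
    · exact hmm ▸ m.mul_mem_left r hs
    · exact Ideal.mul_mem_right s m' ((Submodule.mem_finsetInf.1 hr) m'
        (Finset.mem_erase.2 ⟨hmm, hfin.mem_toFinset.2 hm'⟩))
  obtain ⟨ψ, hψ⟩ := exists_extension_of_ker_le (E := E)
    (f := LinearMap.toSpanSingleton R N x)
    (φ := j.hom ∘ₗ (Submodule.mkQ (Ring.jacobson R)) ∘ₗ LinearMap.mulLeft R r) (by
      intro s hs
      have : r * s ∈ Ring.jacobson R := hrm s (hIm hs)
      have h0 : Submodule.mkQ (Ring.jacobson R) (r * s) = 0 :=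
        (Submodule.Quotient.mk_eq_zero _).2 this
      rw [LinearMap.mem_ker, LinearMap.comp_apply, LinearMap.comp_apply, LinearMap.mulLeft_apply,
        h0, map_zero])
  refine ⟨ψ, fun h0 => hr ?_⟩
  have h1 := LinearMap.congr_fun hψ 1
  simp only [LinearMap.comp_apply, LinearMap.toSpanSingleton_apply, one_smul, h0] at h1
  have h2 := hj (h1.symm.trans (map_zero _).symm)
  have h3 : r ∈ Ring.jacobson R := by
    simpa using (Submodule.Quotient.mk_eq_zero _).1 h2
  exact Ring.jacobson_le_of_isMaximal m h3

/-- Injectivity gives preservation of exactness; the cogenerator property gives its reflection, by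
testing on forms on the cokernel of `f` and on `N`. -/
theorem IsInjectiveCogenerator.exact_iff (hE : IsInjectiveCogenerator E) (f : L →ₗ[R] M)
    (g : M →ₗ[R] N) : Function.Exact f g ↔
      ∀ φ : M →ₗ[R] E, φ ∘ₗ f = 0 ↔ ∃ ψ : N →ₗ[R] E, ψ ∘ₗ g = φ := by
  have := hE.injective
  constructor
  · intro h φ
    constructor
    · intro hφ
      refine exists_extension_of_ker_le fun m hm => ?_
      obtain ⟨l, rfl⟩ := (h m).1 hm
      exact LinearMap.congr_fun hφ l
    · rintro ⟨ψ, rfl⟩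
      rw [LinearMap.comp_assoc, h.linearMap_comp_eq_zero, LinearMap.comp_zero]
  · intro h m
    constructor
    · intro hm
      by_contra hmr
      obtain ⟨φ, hφ⟩ := hE.exists_ne_zero (M ⧸ LinearMap.range f) (Submodule.Quotient.mk m)
        (fun h0 => hmr ((Submodule.Quotient.mk_eq_zero _).1 h0))
      obtain ⟨ψ, hψ⟩ := (h (φ ∘ₗ Submodule.mkQ _)).1 (by
        ext l
        simp [(Submodule.Quotient.mk_eq_zero (LinearMap.range f)).2 ⟨l, rfl⟩])
      apply hφ
      have := LinearMap.congr_fun hψ m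
      rw [LinearMap.comp_apply, hm, map_zero] at this
      exact this.symm
    · rintro ⟨l, rfl⟩
      by_contra hne
      obtain ⟨φ, hφ⟩ := hE.exists_ne_zero N _ hne
      exact hφ (LinearMap.congr_fun ((h (φ ∘ₗ g)).2 ⟨φ, rfl⟩) l)

theorem IsInjectiveCogenerator.exists_finite_separating [IsArtinianRing R]
    (hE : IsInjectiveCogenerator E) (M : Type v) [AddCommGroup M] [Module R M]
    [Module.Finite R M] :
    ∃ (n : ℕ) (φ : Fin n → (M →ₗ[R] E)), ∀ m, (∀ i, φ i m = 0) → m = 0 := by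
  let S : Set (Submodule R M) :=
    {W | ∃ (n : ℕ) (φ : Fin n → (M →ₗ[R] E)), W = ⨅ i, LinearMap.ker (φ i)}
  obtain ⟨W, ⟨n, φ, rfl⟩, hmin⟩ := IsArtinian.set_has_minimal S ⟨_, 0, Fin.elim0, rfl⟩
  refine ⟨n, φ, fun m hm => ?_⟩
  by_contra hne
  obtain ⟨ψ, hψ⟩ := hE.exists_ne_zero M m hne
  -- Adjoining `ψ` strictly shrinks a minimal intersection of kernels, since `m` lies in it while `ψ
  -- m ≠ 0`.
  refine hmin _ ⟨n + 1, Fin.cons ψ φ, rfl⟩ (lt_of_le_of_ne ?_ fun h => hψ ?_)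
  · refine le_iInf fun i => (iInf_le _ i.succ).trans ?_
    simp
  · have hm' : m ∈ ⨅ i, LinearMap.ker (φ i) := by simpa using hm
    rw [← h] at hm'
    have := (Submodule.mem_iInf _).1 hm' 0
    simpa using this

end Cogenerator

/-! ### The duality between mod(C) and mod(Cᵒᵖ) -/

section Duality

variable {R : Type v} [CommRing R] {C : Type u} [Category.{v} C] [Preadditive C] [Linear R C]
variable {E : ModuleCat.{v} R}

theorem IsInAdd.congr {P P' Q Q' : FPMod R C} (hPQ : IsInAdd P Q) (e : P ≅ P') (e' : Q ≅ Q') : IsInAdd P' Q' := by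
  refine isInAdd_of_retract (IsInAdd.trans ?_ hPQ) e'.inv e'.hom e'.inv_hom_id
  exact ⟨1, fun _ => e.hom, fun _ => e.inv, by simp⟩

/-- The functor `mod(C)ᵒᵖ ⥤ mod(Cᵒᵖ)` induced by `Hom_R(-, E)`. -/
def dual (h : ∀ M : (FPMod R C)ᵒᵖ, IsFinitelyPresented R Cᵒᵖ
      (((IsFinitelyPresented R C).ι.op ⋙ dualFunctor R C E).obj M)) :
    (FPMod R C)ᵒᵖ ⥤ FPMod R Cᵒᵖ :=
  (IsFinitelyPresented R Cᵒᵖ).lift ((IsFinitelyPresented R C).ι.op ⋙ dualFunctor R C E) h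

variable (h : ∀ M : (FPMod R C)ᵒᵖ, IsFinitelyPresented R Cᵒᵖ
      (((IsFinitelyPresented R C).ι.op ⋙ dualFunctor R C E).obj M))
variable {L M N : FPMod R C} {x y z w : C}

/-- The elements of the dual of `M` at `z` are the linear maps from `M(z)` to `E`. -/
def dualEl (M : FPMod R C) (z : C) :
    (M.obj.obj z →ₗ[R] E) ≃ₗ[R] ((dual h).obj (op M)).obj.obj (op z) :=
  (ModuleCat.homLinearEquiv (S := R)).symm

@[simp] theorem ev_dual_map (f : M ⟶ N) (φ : N.obj.obj z →ₗ[R] E) :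
    ev ((dual h).map f.op) (op z) (dualEl h N z φ) = dualEl h M z (φ ∘ₗ ev f z) := rfl

@[simp] theorem act_dual (f : z ⟶ w) (φ : M.obj.obj w →ₗ[R] E) :
    act ((dual h).obj (op M)) f.op (dualEl h M w φ) = dualEl h M z (φ ∘ₗ act M f) := rfl

theorem exactSeq_dual_iff (hE : IsInjectiveCogenerator E) (f : L ⟶ M) (g : M ⟶ N) :
    ExactSeq ((dual h).map g.op) ((dual h).map f.op) ↔ ExactSeq f g := by
  refine (Opposite.op_surjective.forall).trans (forall_congr' fun z => ?_)
  refine Iff.trans ?_ (hE.exact_iff (ev f z) (ev g z)).symm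
  refine (dualEl h M z).surjective.forall.trans (forall_congr' fun φ => ?_)
  refine iff_congr ?_ ?_
  · change ev ((dual h).map f.op) (op z) (dualEl h M z φ) = 0 ↔ _
    rw [ev_dual_map, LinearEquiv.map_eq_zero_iff]
  · refine (dualEl h N z).surjective.exists.trans (exists_congr fun ψ => ?_)
    change ev ((dual h).map g.op) (op z) (dualEl h N z ψ) = _ ↔ _
    rw [ev_dual_map, (dualEl h M z).injective.eq_iff]

theorem dual_map_add (f g : M ⟶ N) :
    (dual h).map (f + g).op = (dual h).map f.op + (dual h).map g.op := by
  refine hom_ext fun z k => ?_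
  obtain ⟨φ, rfl⟩ := (dualEl h N z.unop).surjective k
  refine (ev_dual_map h (f + g) φ).trans ?_
  refine Eq.trans ?_ (map_add (dualEl h M z.unop) (φ ∘ₗ ev f z.unop) (φ ∘ₗ ev g z.unop))
  congr 1
  ext m
  simp

theorem dual_map_sum {ι : Type*} (s : Finset ι) (f : ι → (M ⟶ N)) :
    (dual h).map (∑ i ∈ s, f i).op = ∑ i ∈ s, (dual h).map (f i).op :=
  map_sum (AddMonoidHom.mk' (fun f : M ⟶ N => (dual h).map f.op) (dual_map_add h)) f s

variable [(dual h).IsEquivalence]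

theorem exists_dual_iso (Q : FPMod R Cᵒᵖ) :
    ∃ M : FPMod R C, Nonempty ((dual h).obj (op M) ≅ Q) :=
  ⟨((dual h).objPreimage Q).unop, ⟨(dual h).objObjPreimageIso Q⟩⟩

theorem exists_dual_map_eq (g : (dual h).obj (op N) ⟶ (dual h).obj (op M)) :
    ∃ f : M ⟶ N, (dual h).map f.op = g :=
  ⟨((dual h).preimage g).unop, (dual h).map_preimage g⟩

theorem isInAdd_dual_iff (P Q : FPMod R C) :
    IsInAdd ((dual h).obj (op P)) ((dual h).obj (op Q)) ↔ IsInAdd P Q := by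
  constructor
  · rintro ⟨n, s, r, hsr⟩
    choose s' hs' using fun i => exists_dual_map_eq h (s i)
    choose r' hr' using fun i => exists_dual_map_eq h (r i)
    refine ⟨n, r', s', ?_⟩
    apply Quiver.Hom.op_inj
    apply (dual h).map_injective
    rw [dual_map_sum]
    simpa [hs', hr'] using hsr
  · rintro ⟨n, s, r, hsr⟩
    refine ⟨n, fun i => (dual h).map (r i).op, fun i => (dual h).map (s i).op, ?_⟩
    simp only [← Functor.map_comp, ← op_comp]
    rw [← dual_map_sum, hsr, op_id, CategoryTheory.Functor.map_id]

theorem projective_dual_iff (I : FPMod R C) :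
    Projective ((dual h).obj (op I)) ↔ Injective I :=
  ((dual h).asEquivalence.map_projective_iff (op I)).trans
    Injective.injective_iff_projective_op.symm

theorem epi_dual_iff (f : M ⟶ N) : Epi ((dual h).map f.op) ↔ Mono f := by
  rw [(dual h).epi_map_iff_epi]
  constructor
  · intro _
    exact unop_mono_of_epi f.op
  · intro _
    exact op_epi_of_mono f

theorem hasFiniteBiproducts_op [HasFiniteBiproducts C] : HasFiniteBiproducts Cᵒᵖ :=
  HasFiniteBiproducts.of_hasFiniteProducts

/-- Cokernels exist over any additive category; the duality carries those of mod(Cᵒᵖ) to kernels of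
mod(C). -/
theorem hasKernels_of_equivalence [HasFiniteBiproducts C]
    (D : (FPMod R C)ᵒᵖ ⥤ FPMod R Cᵒᵖ) [D.IsEquivalence] : HasKernels (FPMod R C) := by
  have := hasFiniteBiproducts_op (C := C)
  have : HasCoequalizers (FPMod R Cᵒᵖ) := Preadditive.hasCoequalizers_of_hasCokernels
  have : HasCoequalizers (FPMod R C)ᵒᵖ := Adjunction.hasColimitsOfShape_of_equivalence D
  have : HasColimitsOfShape WalkingParallelPairᵒᵖ (FPMod R C)ᵒᵖ :=
    hasColimitsOfShape_of_equivalence walkingParallelPairOpEquiv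
  have : HasEqualizers (FPMod R C) := hasLimitsOfShape_of_hasColimitsOfShape_op
  infer_instance

theorem hasKernels_op_of_equivalence [HasFiniteBiproducts C]
    (D : (FPMod R C)ᵒᵖ ⥤ FPMod R Cᵒᵖ) [D.IsEquivalence] : HasKernels (FPMod R Cᵒᵖ) := by
  have : HasCoequalizers (FPMod R C) := Preadditive.hasCoequalizers_of_hasCokernels
  have : HasEqualizers (FPMod R Cᵒᵖ) := Adjunction.hasLimitsOfShape_of_equivalence D.inv
  infer_instance

end Duality

/-! ### Transfer of resolutions through the duality -/

section Transfer

variable {R : Type v} [CommRing R] {C : Type u} [Category.{v} C] [Preadditive C] [Linear R C]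
variable {E : ModuleCat.{v} R} {L L' M M' N N' : FPMod R C} {x y z w d : C}

@[simp] theorem ev_iso_hom_inv (e : M ≅ N) (n : N.obj.obj z) : ev e.hom z (ev e.inv z n) = n := by
  rw [← ev_comp, e.inv_hom_id, ev_id]

@[simp] theorem ev_iso_inv_hom (e : M ≅ N) (m : M.obj.obj z) : ev e.inv z (ev e.hom z m) = m := by
  rw [← ev_comp, e.hom_inv_id, ev_id]

theorem ExactSeq.of_iso {f : L ⟶ M} {g : M ⟶ N} (h : ExactSeq f g) (a : L' ≅ L) (b : M' ≅ M)
    (t : N ⟶ N') [Mono t] : ExactSeq (a.hom ≫ f ≫ b.inv) (b.hom ≫ g ≫ t) := by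
  refine exactSeq_iff.2 fun z m => ?_
  simp only [ev_comp]
  rw [map_eq_zero_iff _ (mono_iff_injective.1 ‹Mono t› z)]
  refine (exactSeq_iff.1 h z _).trans ⟨?_, ?_⟩
  · rintro ⟨k, hk⟩
    exact ⟨ev a.inv z k, by simp [hk]⟩
  · rintro ⟨k, rfl⟩
    exact ⟨ev a.hom z k, by simp⟩

variable (h : ∀ M : (FPMod R C)ᵒᵖ, IsFinitelyPresented R Cᵒᵖ
      (((IsFinitelyPresented R C).ι.op ⋙ dualFunctor R C E).obj M)) [(dual h).IsEquivalence]

/-- Injective coresolutions correspond to projective resolutions of the dual. -/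
theorem projSub_dual_iff [HasFiniteBiproducts C] (hE : IsInjectiveCogenerator E) {J : FPMod R C}
    {P : FPMod R Cᵒᵖ}
    (hJ : ∀ I : FPMod R C, IsInAdd P ((dual h).obj (op I)) ↔ IsInAdd J I) (k : ℕ∞)
    (Y : FPMod R C) :
    projSub P k ((dual h).obj (op Y)) ↔
      ∃ (I : ℕ → FPMod R C) (d : ∀ n, I n ⟶ I (n + 1)) (η : Y ⟶ I 0),
        (∀ n, Injective (I n)) ∧
        (∀ Z : C, Function.Injective (η.hom.app Z).hom) ∧
        ExactSeq η (d 0) ∧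
        (∀ n, ExactSeq (d n) (d (n + 1))) ∧
        ∀ n : ℕ, (n : ℕ∞) ≤ k → IsInAdd J (I n) := by
  have := hasFiniteBiproducts_op (C := C)
  constructor
  · rintro ⟨Q, d, ε, hQ, hε, h0, hd, hk⟩
    choose I e using fun n => exists_dual_iso h (Q n)
    replace e := fun n => (e n).some
    choose d' hd' using fun n =>
      exists_dual_map_eq h ((e (n + 1)).hom ≫ d n ≫ (e n).inv)
    obtain ⟨η, hη⟩ := exists_dual_map_eq h ((e 0).hom ≫ ε)
    refine ⟨I, d', η, fun n => ?_, ?_, ?_, fun n => ?_, fun n hn => ?_⟩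
    · rw [← projective_dual_iff h]
      have := hQ n
      exact Projective.of_iso (e n).symm this
    · refine mono_iff_injective.1 ((epi_dual_iff h η).1 ?_)
      have : Epi ε := epi_of_surjective hε
      rw [hη]
      infer_instance
    · rw [← exactSeq_dual_iff h hE, hd', hη]
      simpa using h0.of_iso (e 1) (e 0) (𝟙 _)
    · rw [← exactSeq_dual_iff h hE, hd', hd']
      exact (hd n).of_iso (e (n + 2)) (e (n + 1)) (e n).inv
    · rw [← hJ]
      exact (hk n hn).congr (Iso.refl P) (e n).symm
  · rintro ⟨I, d, η, hI, hη, h0, hd, hk⟩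
    refine ⟨fun n => (dual h).obj (op (I n)), fun n => (dual h).map (d n).op,
      (dual h).map η.op, fun n => (projective_dual_iff h _).2 (hI n), ?_,
      (exactSeq_dual_iff h hE _ _).2 h0, fun n => (exactSeq_dual_iff h hE _ _).2 (hd n),
      fun n hn => (hJ _).2 (hk n hn)⟩
    exact epi_iff_surjective.1 ((epi_dual_iff h η).2 (mono_iff_injective.2 hη))

theorem projSub_of_iso {P X X' : FPMod R C} {k : ℕ∞} (e : X ≅ X') (hX : projSub P k X) :
    projSub P k X' := by
  obtain ⟨Q, d, ε, hQ, hε, h0, hd, hk⟩ := hX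
  refine ⟨Q, d, ε ≫ e.hom, hQ, fun z m => ?_, ?_, hd, hk⟩
  · obtain ⟨n, hn⟩ := hε z (ev e.inv z m)
    have hn : ev ε z n = ev e.inv z m := hn
    refine ⟨n, ?_⟩
    change ev (ε ≫ e.hom) z n = m
    simp [hn]
  · simpa using h0.of_iso (Iso.refl _) (Iso.refl _) e.hom

/-- If the dual of `J` is represented by `d`, then a linear form on `M(d)` induces a morphism
`M ⟶ J` with the expected kernel. -/
theorem exists_hom_of_form {J : FPMod R C} (e : (dual h).obj (op J) ≅ rep R (op d))
    (φ : M.obj.obj d →ₗ[R] E) : ∃ ψ : M ⟶ J, (dual h).map ψ.op = e.hom ≫ yo (dualEl h M d φ) ∧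
      ∀ (z : C) (m : M.obj.obj z), ev ψ z m = 0 ↔ ∀ a : z ⟶ d, φ (act M a m) = 0 := by
  obtain ⟨ψ, hψ⟩ := exists_dual_map_eq h (e.hom ≫ yo (dualEl h M d φ))
  refine ⟨ψ, hψ, fun z m => ?_⟩
  have hyo : ∀ {B : Type u} [Category.{v} B] [Preadditive B] [Linear R B] {M : FPMod R B} {z : B}
      (m : M.obj.obj z), yo m = 0 ↔ m = 0 := fun m => by
    refine ⟨fun h => by simpa using congrArg (fun g => ev g _ (el (𝟙 _))) h, ?_⟩
    rintro rfl
    exact hom_ext fun z k => by simp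
  have h0 : (dual h).map (0 : rep R z ⟶ J).op = 0 :=
    map_zero (AddMonoidHom.mk' (fun f : rep R z ⟶ J => (dual h).map f.op) (dual_map_add h))
  rw [← hyo, ← yo_comp, ← Quiver.Hom.op_inj.eq_iff, ← (dual h).map_injective.eq_iff, h0, op_comp,
    Functor.map_comp, hψ, Category.assoc, yo_comp, ← cancel_epi e.inv, Iso.inv_hom_id_assoc,
    comp_zero, hyo, ev_dual_map, LinearEquiv.map_eq_zero_iff, LinearMap.ext_iff]
  refine (el (R := R)).surjective.forall.trans (forall_congr' fun a => ?_)
  simp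

end Transfer

/-! ### Fitting's lemma and minimal idempotents -/

section Fitting

variable {R A : Type*} [CommRing R] [Ring A] [Algebra R A]

/-- Fitting's lemma for an element of an algebra that is finite over an artinian ring. -/
theorem exists_idempotent_of_pow [IsArtinianRing R] [Module.Finite R A] (a : A) :
    ∃ (n : ℕ) (p x : A), p * p = p ∧ a ^ (n + 1) * x = p ∧ x * a ^ (n + 1) = p ∧
      p * a ^ (n + 1) = a ^ (n + 1) := by
  obtain ⟨n, hn, hc⟩ := ((Filter.eventually_ge_atTop 1).and
    (LinearMap.mulLeft R a).eventually_isCompl_ker_pow_range_pow).exists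
  obtain ⟨n, rfl⟩ : ∃ m, n = m + 1 := ⟨n - 1, by omega⟩
  rw [LinearMap.pow_mulLeft] at hc
  refine ⟨n, ?_⟩
  generalize a ^ (n + 1) = b at hc ⊢
  -- Left multiplication by b is injective on bA. Together with 1 = k + b x and b k = 0, this makes
  -- b x the idempotent sought.
  have hz : ∀ c, b * (b * c) = 0 → b * c = 0 := fun c hc0 =>
    (Submodule.disjoint_def.1 hc.disjoint) (b * c) hc0 ⟨c, rfl⟩
  obtain ⟨k, hk, _, ⟨x, rfl⟩, h1⟩ := Submodule.mem_sup.1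
    (hc.sup_eq_top ▸ Submodule.mem_top : (1 : A) ∈ _)
  have hk : b * k = 0 := hk
  have h1 : k + b * x = 1 := h1
  have hbp : b * (b * x) = b := by
    rw [← zero_add (b * (b * x)), ← hk, ← mul_add, h1, mul_one]
  have hpb : b * x * b = b := by
    have : b * (1 - x * b) = 0 := hz _ (by
      rw [mul_sub, mul_sub, mul_one, ← mul_assoc b x b, ← mul_assoc b (b * x) b, hbp, sub_self])
    rw [mul_sub, mul_one, sub_eq_zero, ← mul_assoc] at this
    exact this.symm
  have hpp : b * x * (b * x) = b * x := by rw [← mul_assoc, hpb]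
  refine ⟨b * x, b * x * x * (b * x), hpp, ?_, ?_, hpb⟩
  · calc b * (b * x * x * (b * x)) = b * (b * x) * x * (b * x) := by simp only [mul_assoc]
      _ = b * x := by rw [hbp, hpp]
  · have : b * (x * x * (b * x) * b - x) = 0 := hz _ (by
      calc b * (b * (x * x * (b * x) * b - x)) =
          b * (b * x) * x * (b * x * b) - b * (b * x) := by
            simp only [mul_assoc, mul_sub]
        _ = 0 := by rw [hbp, hpb, hpb, sub_self])
    rw [mul_sub, sub_eq_zero] at this
    simpa only [mul_assoc] using this

/-- A minimal idempotent among those satisfying `Q`. -/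
theorem exists_minimal_idempotent [IsArtinianRing R] [Module.Finite R A] (Q : A → Prop)
    (h1 : Q 1) (hmul : ∀ a b, Q a → Q b → Q (a * b)) (hcancel : ∀ a b, Q b → Q (a * b) → Q a) :
    ∃ p, p * p = p ∧ Q p ∧
      ∀ a, p * a = a → a * p = a → Q a → ∃ x y, a * x = p ∧ y * a = p := by
  let S : Set (Submodule R A) :=
    {W | ∃ p, p * p = p ∧ Q p ∧ W = LinearMap.range (LinearMap.mulLeft R p)}
  have : IsArtinian R A := inferInstance
  obtain ⟨W, ⟨p, hp, hQ, rfl⟩, hmin⟩ := IsArtinian.set_has_minimal S ⟨_, 1, by simp, h1, rfl⟩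
  refine ⟨p, hp, hQ, fun a hpa hap ha => ?_⟩
  obtain ⟨n, q, x, hq, hax, hxa, hqa⟩ := exists_idempotent_of_pow (R := R) a
  have hQa : Q (a ^ (n + 1)) := by
    clear hax hxa hqa
    induction n with
    | zero => simpa using ha
    | succ n ih => rw [pow_succ]; exact hmul _ _ ih ha
  -- The Fitting idempotent q of a again satisfies `Q` and lies below p, so minimality of pA forces
  -- q = p.
  have hQq : Q q := hcancel _ _ hQa (by rwa [hqa])
  have hpq : p * q = q := by rw [← hax, pow_succ', ← mul_assoc, ← mul_assoc, hpa]
  have hqp : q * p = q := by rw [← hxa, pow_succ, mul_assoc, mul_assoc, hap]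
  have hle : LinearMap.range (LinearMap.mulLeft R q) ≤ LinearMap.range (LinearMap.mulLeft R p) := by
    rintro _ ⟨c, rfl⟩
    exact ⟨q * c, by simp [← mul_assoc, hpq]⟩
  have heq := hle.eq_or_lt.resolve_right (hmin _ ⟨q, hq, hQq, rfl⟩)
  obtain ⟨c, hc⟩ : p ∈ LinearMap.range (LinearMap.mulLeft R q) := heq ▸ ⟨1, by simp⟩
  have hc : q * c = p := hc
  have hqeq : q = p := by rw [← hqp, ← hc, ← mul_assoc, hq]
  refine ⟨a ^ n * x, x * a ^ n, ?_, ?_⟩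
  · rw [← mul_assoc, ← pow_succ', hax, hqeq]
  · rw [mul_assoc, ← pow_succ, hxa, hqeq]

end Fitting

/-! ### Projective covers -/

section ProjectiveCover

variable {R : Type v} [CommRing R] {C : Type u} [Category.{v} C] [Preadditive C] [Linear R C]

/-- Every generator of a module can be cut down to one whose endomorphisms are all
isomorphisms. -/
theorem exists_minimal_generator [IsArtinianRing R] [IsIdempotentComplete C]
    (hf : ∀ X Y : C, Module.Finite R (X ⟶ Y)) {S : FPMod R C} {b₀ : C} {s₀ : S.obj.obj b₀}
    (hs₀ : Generates s₀) : ∃ (b : C) (i : b ⟶ b₀) (r : b₀ ⟶ b) (s : S.obj.obj b), i ≫ r = 𝟙 b ∧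
      Generates s ∧ ∀ a : b ⟶ b, act S a s = s → IsIso a := by
  have : Module.Finite R (End b₀) := hf b₀ b₀
  -- Minimality is taken among idempotents fixing `s₀`; the image `b` of `p` then carries a
  -- generator fixed only by automorphisms.
  obtain ⟨p, hp, hps, hpmin⟩ := exists_minimal_idempotent (R := R) (A := End b₀)
    (fun a => act S (a : b₀ ⟶ b₀) s₀ = s₀) (act_id _)
    (fun a b ha hb => (act_comp b a s₀).trans (by rw [hb, ha]))
    (fun a b hb hab => by
      have := (act_comp b a s₀).symm.trans hab
      rwa [hb] at this)
  obtain ⟨b, i, r, hir, hri⟩ := IsIdempotentComplete.idempotents_split b₀ (p : b₀ ⟶ b₀) hp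
  refine ⟨b, i, r, act S r s₀, hir, fun z k => ?_, fun a ha => ?_⟩
  · obtain ⟨t, rfl⟩ := hs₀ z k
    refine ⟨i ≫ t, ?_⟩
    rw [← act_comp, ← Category.assoc, hri, act_comp, hps]
  · have hpri : p = r ≫ i := hri.symm
    obtain ⟨x, y, hx, hy⟩ := hpmin (r ≫ a ≫ i)
      (by
        change (r ≫ a ≫ i) ≫ p = r ≫ a ≫ i
        rw [hpri]
        simp [reassoc_of% hir])
      (by
        change p ≫ (r ≫ a ≫ i) = r ≫ a ≫ i
        rw [hpri]
        simp [reassoc_of% hir])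
      (by
        rw [act_comp, act_comp, ha, ← act_comp, hri, hps])
    have hx : x ≫ r ≫ a ≫ i = p := hx
    have hy : (r ≫ a ≫ i) ≫ y = p := hy
    have hx' : (i ≫ x ≫ r) ≫ a = 𝟙 b := by
      have := congrArg (fun t => i ≫ t ≫ r) hx
      simpa [hpri, hir, reassoc_of% hir] using this
    have hy' : a ≫ (i ≫ y ≫ r) = 𝟙 b := by
      have := congrArg (fun t => i ≫ t ≫ r) hy
      simpa [hpri, hir, reassoc_of% hir] using this
    have hxy : i ≫ x ≫ r = i ≫ y ≫ r := by
      rw [← Category.comp_id (i ≫ x ≫ r), ← hy', ← Category.assoc, hx', Category.id_comp]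
    exact ⟨i ≫ y ≫ r, hy', by rw [← hxy, hx']⟩

/-- A minimal generator defines a superfluous epimorphism. -/
theorem epi_of_epi_comp_yo [HasFiniteBiproducts C] {S Z : FPMod R C} {b : C} {s : S.obj.obj b}
    (hs : ∀ a : b ⟶ b, act S a s = s → IsIso a) (g : Z ⟶ rep R b) (hg : Epi (g ≫ yo s)) :
    Epi g := by
  obtain ⟨y, hy⟩ := epi_iff_surjective.1 hg b s
  -- The image of `g` contains an `a` that fixes `s`; as `a` is invertible, the image contains the
  -- identity as well.
  let a : b ⟶ b := el.symm (ev g b y)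
  have : IsIso a := hs a hy
  refine epi_of_surjective fun z k => ⟨act Z (inv a ≫ el.symm k) y, ?_⟩
  have hga : ev g b y = el a := (LinearEquiv.apply_symm_apply _ _).symm
  rw [ev_act, hga, act_el, IsIso.hom_inv_id_assoc, LinearEquiv.apply_symm_apply]

end ProjectiveCover

/-! ### Jacobson radicals and the radical of a representable module -/

section Jacobson

theorem exists_mul_one_sub_eq_one {A : Type*} [Ring A] {j : A} (hj : j ∈ Ring.jacobson A) :
    ∃ u, u * (1 - j) = 1 := by
  by_contra hne
  have hI : Ideal.span {1 - j} ≠ ⊤ := fun h => hne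
    (Ideal.mem_span_singleton'.1 (h ▸ Submodule.mem_top : (1 : A) ∈ Ideal.span {1 - j}))
  obtain ⟨m, hm, hle⟩ := Ideal.exists_le_maximal _ hI
  have h1 : 1 - j ∈ m := hle (Ideal.mem_span_singleton_self _)
  have h2 : j ∈ m := Ring.jacobson_le_of_isMaximal m hj
  exact hm.ne_top ((Ideal.eq_top_iff_one m).2 (by simpa using m.add_mem h1 h2))

/-- A two-sided ideal `I` of an artinian ring equals the ring if it is only annihilated, modulo
the radical, by the radical. -/
theorem eq_top_of_annihilator_le_jacobson {A : Type*} [Ring A] [IsArtinianRing A] (I : Ideal A)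
    (hI : ∀ a ∈ I, ∀ b, a * b ∈ I)
    (h : ∀ b, (∀ a ∈ I, a * b ∈ Ring.jacobson A) → b ∈ Ring.jacobson A) : I = ⊤ := by
  let π := Submodule.mkQ (Ring.jacobson A)
  have hπ : ∀ a, π a = 0 ↔ a ∈ Ring.jacobson A := fun a => Submodule.Quotient.mk_eq_zero _
  have : IsSemisimpleModule A (A ⧸ Ring.jacobson A) :=
    (IsArtinian.isSemisimpleModule_iff_jacobson A _).2 (Module.jacobson_quotient_jacobson A A)
  obtain ⟨W, hW⟩ := exists_isCompl (Submodule.map π I)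
  -- Since I is two-sided, I·W lies in both the image of I and its complement W, hence vanishes; the
  -- hypothesis then gives W = 0.
  have hW0 : ∀ b, π b ∈ W → π b = 0 := fun b hb => (hπ b).2 (h b fun a ha => (hπ _).1
    (Submodule.disjoint_def.1 hW.disjoint _ ⟨a * b, hI a ha b, rfl⟩ (by
      rw [← smul_eq_mul, map_smul]
      exact W.smul_mem a hb)))
  obtain ⟨_, ⟨a, ha, rfl⟩, w, hw, h1⟩ := Submodule.mem_sup.1
    (hW.sup_eq_top ▸ Submodule.mem_top : π 1 ∈ Submodule.map π I ⊔ W)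
  obtain ⟨b, rfl⟩ := Submodule.mkQ_surjective _ w
  have hb : π b = 0 := hW0 b hw
  have h1 : π a + π b = π 1 := h1
  rw [hb, add_zero, eq_comm, ← sub_eq_zero, ← map_sub, hπ] at h1
  obtain ⟨u, hu⟩ := exists_mul_one_sub_eq_one h1
  rw [Ideal.eq_top_iff_one, ← hu, sub_sub_cancel]
  exact I.mul_mem_left u ha

end Jacobson

section Radical

variable {R : Type v} [CommRing R] {C : Type u} [Category.{v} C] [Preadditive C] [Linear R C]
variable {c z : C}

/-- The maximal submodule of `Hom(c, -)` determined by a maximal left ideal of `End(c)`. -/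
theorem exists_isMaximal_of_ideal (m : Ideal (End c)) (hm : m.IsMaximal) :
    ∃ N : Submod (rep R c).obj, N.IsMaximal ∧
      ∀ (z : C) (g : c ⟶ z), el g ∈ N.obj z ↔ ∀ a : z ⟶ c, End.of (g ≫ a) ∈ m := by
  have hmr : ∀ (f : c ⟶ c) (a : c ⟶ c), End.of f ∈ m → End.of (f ≫ a) ∈ m :=
    fun f a hf => m.mul_mem_left (End.of a) hf
  let N : Submod (rep R c).obj :=
    { obj := fun z =>
        { carrier := {g | ∀ a : z ⟶ c, End.of (el.symm g ≫ a) ∈ m}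
          zero_mem' := fun a => by
            rw [map_zero, zero_comp]
            exact m.zero_mem
          add_mem' := fun {g g'} hg hg' a => by
            rw [map_add, Preadditive.add_comp]
            exact m.add_mem (hg a) (hg' a)
          smul_mem' := fun r g hg a => by
            have := hmr _ (r • 𝟙 c) (hg a)
            simpa using this }
      map_mem := fun {z w} f x hx a => by
        have := hx (f ≫ a)
        rwa [← Category.assoc] at this }
  have hN : ∀ (z : C) (g : c ⟶ z), el g ∈ N.obj z ↔ ∀ a : z ⟶ c, End.of (g ≫ a) ∈ m :=
    fun z g => Iff.rfl
  refine ⟨N, ⟨⟨c, fun h => ?_⟩, fun N' hN' => ?_⟩, hN⟩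
  · have := (hN c (𝟙 c)).1 (h ▸ Submodule.mem_top) (𝟙 c)
    rw [Category.comp_id] at this
    exact hm.ne_top ((Ideal.eq_top_iff_one m).2 this)
  · by_cases hle : ∀ z, N'.obj z ≤ N.obj z
    · exact Or.inl (Submod.ext (funext fun z => le_antisymm (hle z) (hN' z)))
    · right
      push Not at hle
      obtain ⟨z, hz⟩ := hle
      obtain ⟨g, hg, hgN⟩ := Set.not_subset.1 hz
      obtain ⟨g, rfl⟩ := (el (R := R)).surjective g
      have hgN : ¬ el g ∈ N.obj z := hgN
      rw [hN] at hgN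
      push Not at hgN
      obtain ⟨a, ha⟩ := hgN
      have htop : m ⊔ Ideal.span {End.of (g ≫ a)} = ⊤ := by
        by_contra hne
        refine ha ?_
        rw [hm.eq_of_le hne le_sup_left]
        exact Submodule.mem_sup_right (Ideal.mem_span_singleton_self _)
      obtain ⟨l, hl, k, hk, hlk⟩ := Submodule.mem_sup.1
        (htop ▸ Submodule.mem_top : (1 : End c) ∈ m ⊔ Ideal.span {End.of (g ≫ a)})
      obtain ⟨b, rfl⟩ := Ideal.mem_span_singleton'.1 hk
      have h1 : (el (𝟙 c) : (rep R c).obj.obj c) ∈ N'.obj c := by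
        have e1 : (el (R := R) (l : c ⟶ c)) ∈ N'.obj c :=
          hN' c ((hN c l).2 fun a => hmr l a hl)
        have e2 : el ((g ≫ a) ≫ (b : c ⟶ c)) ∈ N'.obj c := by
          rw [Category.assoc]
          exact N'.map_mem (a ≫ b) _ hg
        have := (N'.obj c).add_mem e1 e2
        rw [← map_add] at this
        convert this using 2
        exact hlk.symm
      intro w
      rw [eq_top_iff]
      intro k _
      have := N'.map_mem (el.symm k) _ h1
      change act (rep R c) _ _ ∈ _ at this
      rwa [act_el, Category.id_comp, LinearEquiv.apply_symm_apply] at this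

/-- Maximal left ideals of End(c) give maximal submodules, whence one direction. For the other, a
maximal N missing g satisfies 𝟙 = n + g ≫ k with n in N; as g ≫ k is in the radical, n ≫ u = 𝟙 for
some u, and N would be everything. -/
theorem el_mem_radical_iff (g : c ⟶ z) : el g ∈ (radical (rep R c).obj).obj z ↔
    ∀ a : z ⟶ c, End.of (g ≫ a) ∈ Ring.jacobson (End c) := by
  have hrad : el g ∈ (radical (rep R c).obj).obj z ↔
      ∀ N : Submod (rep R c).obj, N.IsMaximal → el g ∈ N.obj z := by
    simp only [radical, Submodule.mem_iInf]
  rw [hrad]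
  constructor
  · intro h a
    rw [Ring.jacobson_eq_sInf_isMaximal, Submodule.mem_sInf]
    intro m hm
    obtain ⟨N, hN, hNm⟩ := exists_isMaximal_of_ideal (R := R) m hm
    exact (hNm z g).1 (h N hN) a
  · intro h N hN
    by_contra hgN
    let N' : Submod (rep R c).obj :=
      { obj := fun w => N.obj w ⊔ LinearMap.range (ev (yo (R := R) (el g)) w)
        map_mem := fun {w w'} f x hx => by
          obtain ⟨n, hn, _, ⟨k, rfl⟩, rfl⟩ := Submodule.mem_sup.1 hx
          change act (rep R c) f _ ∈ _
          rw [map_add, ← ev_act]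
          exact Submodule.add_mem_sup (N.map_mem f n hn) ⟨_, rfl⟩ }
    have hgN' : el g ∈ N'.obj z := Submodule.mem_sup_right ⟨el (𝟙 z), by simp⟩
    rcases hN.2 N' (fun w => le_sup_left) with h' | h'
    · rw [h'] at hgN'
      exact hgN hgN'
    · obtain ⟨n, hn, _, ⟨k, rfl⟩, hnk⟩ := Submodule.mem_sup.1
        (h' c ▸ Submodule.mem_top : (el (𝟙 c) : (rep R c).obj.obj c) ∈ N'.obj c)
      obtain ⟨k, rfl⟩ := (el (R := R)).surjective k
      obtain ⟨n, rfl⟩ := (el (R := R)).surjective n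
      obtain ⟨u, hu⟩ := exists_mul_one_sub_eq_one (h k)
      rw [ev_yo, LinearEquiv.symm_apply_apply, act_el, ← map_add,
        (el (R := R)).injective.eq_iff, ← eq_sub_iff_add_eq] at hnk
      have h1 : (el (𝟙 c) : (rep R c).obj.obj c) ∈ N.obj c := by
        have := N.map_mem (u : c ⟶ c) _ hn
        change act (rep R c) _ _ ∈ _ at this
        rw [act_el, hnk] at this
        convert this using 2
        exact hu.symm
      obtain ⟨⟨w, hw⟩, -⟩ := hN
      refine hw (eq_top_iff.2 fun k _ => ?_)
      have := N.map_mem (el.symm k) _ h1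
      change act (rep R c) _ _ ∈ _ at this
      rwa [act_el, Category.id_comp, LinearEquiv.apply_symm_apply] at this

end Radical

/-! ### The top of P and its injective envelope -/

section Envelope

variable {R : Type v} [CommRing R] {C : Type u} [Category.{v} C] [Preadditive C] [Linear R C]
variable {E : ModuleCat.{v} R} {c x y z : C}
variable (h : ∀ M : (FPMod R C)ᵒᵖ, IsFinitelyPresented R Cᵒᵖ
      (((IsFinitelyPresented R C).ι.op ⋙ dualFunctor R C E).obj M)) [(dual h).IsEquivalence]

/-- The top of a representable module is finitely presented, and embeds into an injective module
whose dual is represented by a finite sum of copies of the representing object. -/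
theorem exists_top [IsArtinianRing R] [HasFiniteBiproducts C]
    (hf : ∀ X Y : C, Module.Finite R (X ⟶ Y)) (hE : IsInjectiveCogenerator E) (c : C) :
    ∃ (T : FPMod R C) (_ : T.obj ≅ (radical (rep R c).obj).quotient) (q : rep R c ⟶ T),
      (∀ z, Function.Surjective (ev q z)) ∧
      (∀ (z : C) (g : c ⟶ z), ev q z (el g) = 0 ↔
        ∀ a : z ⟶ c, End.of (g ≫ a) ∈ Ring.jacobson (End c)) ∧
      ∃ (n : ℕ) (J : FPMod R C)
        (_ : (dual h).obj (op J) ≅ rep R (op (⨁ fun _ : Fin n => c))) (t : T ⟶ J), Mono t := by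
  have := hasKernels_of_equivalence (dual h)
  have : Module.Finite R ((rep R c).obj.obj c) := hf c c
  obtain ⟨n, φ, hφ⟩ := hE.exists_finite_separating
    ((rep R c).obj.obj c ⧸ (radical (rep R c).obj).obj c)
  let d := ⨁ fun _ : Fin n => c
  obtain ⟨J, ⟨e⟩⟩ := exists_dual_iso h (rep R (op d))
  -- Testing Φ along all maps z ⟶ cⁿ tests every `φ i` along all maps z ⟶ c, so the induced ψ : P ⟶
  -- J has kernel exactly rad(P).
  let Φ : (rep R c).obj.obj d →ₗ[R] E :=
    ∑ i, φ i ∘ₗ Submodule.mkQ _ ∘ₗ act (rep R c) (biproduct.π (fun _ : Fin n => c) i)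
  obtain ⟨ψ, -, hψ⟩ := exists_hom_of_form h e Φ
  have hjac : ∀ f : c ⟶ c, Submodule.Quotient.mk (el f) =
      (0 : (rep R c).obj.obj c ⧸ (radical (rep R c).obj).obj c) ↔
      End.of f ∈ Ring.jacobson (End c) := fun f => by
    rw [Submodule.Quotient.mk_eq_zero, el_mem_radical_iff]
    refine ⟨fun h => by simpa using h (𝟙 c), fun h a => ?_⟩
    exact (Ring.jacobson (End c)).mul_mem_left (End.of a) h
  have hψ' : ∀ (z : C) (g : c ⟶ z), ev ψ z (el g) = 0 ↔
      ∀ a : z ⟶ c, End.of (g ≫ a) ∈ Ring.jacobson (End c) := by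
    intro z g
    have hΦ : ∀ a : z ⟶ d, Φ (act (rep R c) a (el g)) =
        ∑ i, φ i (Submodule.Quotient.mk (el (g ≫ a ≫ biproduct.π (fun _ : Fin n => c) i))) :=
      fun a => by simp [Φ]
    rw [hψ]
    constructor
    · intro H a
      rw [← hjac]
      refine hφ _ fun i => ?_
      have := H (a ≫ biproduct.ι (fun _ : Fin n => c) i)
      rw [hΦ, Finset.sum_eq_single i] at this
      · simpa using this
      · intro j _ hj
        simp [biproduct.ι_π_ne _ hj.symm]
      · simp
    · intro H a
      rw [hΦ]
      refine Finset.sum_eq_zero fun i _ => ?_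
      rw [(hjac _).2 (H _), map_zero]
  let Q := (radical (rep R c).obj).quotient
  let q : (rep R c).obj ⟶ Q :=
    { app := fun z => ModuleCat.ofHom (Submodule.mkQ _)
      naturality := fun z w h => by
        ext k
        rfl }
  have hq : ∀ (z : C) (g : c ⟶ z), (q.app z).hom (el g) = 0 ↔
      ∀ a : z ⟶ c, End.of (g ≫ a) ∈ Ring.jacobson (End c) := fun z g =>
    (Submodule.Quotient.mk_eq_zero _).trans (el_mem_radical_iff g)
  have hqs : ∀ z, Function.Surjective (q.app z).hom := fun z => Submodule.mkQ_surjective _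
  -- Since ker ψ = rad(P), a cover of it supplies the relation presenting P/rad(P).
  obtain ⟨x, g, hg⟩ := exists_cover_kernel ψ
  have hQ : IsFinitelyPresented R C Q := by
    refine isFinitelyPresented_of_generates q hqs (el.symm (ev g x (el (𝟙 x)))) fun z a => ?_
    rw [hq, ← hψ']
    refine (hg z (el a)).trans ((el (R := R)).surjective.exists.trans (exists_congr fun k => ?_))
    change ev g z (el k) = el a ↔ _
    rw [ev_el, ← LinearEquiv.symm_apply_eq, el_symm_act]
  let T : FPMod R C := ⟨Q, hQ⟩
  let q' : rep R c ⟶ T := ObjectProperty.homMk q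
  obtain ⟨t, ht⟩ := exists_desc (q := q') hqs ψ fun z m hm => by
    obtain ⟨m, rfl⟩ := (el (R := R)).surjective m
    exact (hψ' z m).2 ((hq z m).1 hm)
  refine ⟨T, Iso.refl _, q', hqs, hq, n, J, e, t, mono_iff_injective.2 fun z => ?_⟩
  rw [injective_iff_map_eq_zero]
  intro k hk
  obtain ⟨k, rfl⟩ := hqs z k
  obtain ⟨k, rfl⟩ := (el (R := R)).surjective k
  refine (hq z k).2 ((hψ' z k).1 ?_)
  rw [← ht]
  exact hk

/-- A submodule of an injective module with representable dual has an injective envelope. -/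
theorem exists_isInjectiveEnvelope [IsArtinianRing R] [HasFiniteBiproducts C]
    [IsIdempotentComplete C] (hf : ∀ X Y : C, Module.Finite R (X ⟶ Y)) {T J₀ : FPMod R C} {d : Cᵒᵖ}
    (e : (dual h).obj (op J₀) ≅ rep R d) (t : T ⟶ J₀) [Mono t] :
    ∃ (J : FPMod R C) (f : T ⟶ J), IsInjectiveEnvelope f := by
  have := hasFiniteBiproducts_op (C := C)
  have : Epi ((dual h).map t.op) := (epi_dual_iff h t).2 inferInstance
  let s₀ := ev (e.inv ≫ (dual h).map t.op) d (el (𝟙 d))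
  have hs₀ : Generates s₀ := by
    rw [generates_iff, yo_ev]
    exact epi_iff_surjective.1 inferInstance
  -- This is a projective cover of the dual of `T`; dualizing turns a superfluous epimorphism into
  -- an essential monomorphism.
  obtain ⟨b, -, -, s, -, hs, hsa⟩ := exists_minimal_generator (finite_hom_op hf) hs₀
  have : Epi (yo s) := epi_of_surjective (generates_iff.1 hs)
  obtain ⟨J, ⟨e'⟩⟩ := exists_dual_iso h (rep R b)
  obtain ⟨j, hj⟩ := exists_dual_map_eq h (e'.hom ≫ yo s)
  refine ⟨J, j, ?_, ?_, fun {Z} g hg => ?_⟩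
  · rw [← epi_dual_iff h, hj]
    infer_instance
  · rw [← projective_dual_iff h]
    exact Projective.of_iso e'.symm (projective_rep b)
  · rw [← epi_dual_iff h, op_comp, Functor.map_comp, hj, ← Category.assoc] at hg
    have := epi_of_epi_comp_yo hsa _ hg
    rw [← epi_dual_iff h]
    have h1 : (dual h).map g.op = ((dual h).map g.op ≫ e'.hom) ≫ e'.inv := by simp
    rw [h1]
    infer_instance

theorem isInAdd_rep_op_biproduct [HasFiniteBiproducts C] (c : C) (n : ℕ) :
    IsInAdd (rep R (op c)) (rep R (op (⨁ fun _ : Fin n => c))) := by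
  refine isInAdd_rep (fun i => (biproduct.π (fun _ : Fin n => c) i).op)
    (fun i => (biproduct.ι (fun _ : Fin n => c) i).op) ?_
  simp only [← op_comp]
  rw [← op_sum, biproduct.total, op_id]

end Envelope

/-! ### The trace ideal -/

section Trace

variable {R : Type v} [CommRing R] {C : Type u} [Category.{v} C] [Preadditive C] [Linear R C]

/-- The endomorphisms of `c` in `C` whose induced endomorphism of `Hom(-, c)` factors through a
finite sum of copies of `Q`. -/
def traceIdeal (Q : FPMod R Cᵒᵖ) (c : C) : Ideal (End c) where
  carrier := {a | ∃ (n : ℕ) (s : Fin n → (rep R (op c) ⟶ Q)) (r : Fin n → (Q ⟶ rep R (op c))),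
    ∑ i, s i ≫ r i = repMap (Quiver.Hom.op (a : c ⟶ c))}
  zero_mem' := ⟨0, Fin.elim0, Fin.elim0, by
    refine hom_ext fun z k => ?_
    rw [ev_yo, Finset.univ_eq_empty, Finset.sum_empty, ev_zero]
    exact (map_zero (act (rep R (op c)) (el.symm k))).symm⟩
  add_mem' := by
    rintro a b ⟨n, s, r, h⟩ ⟨n', s', r', h'⟩
    refine ⟨n + n', Fin.append s s', Fin.append r r', ?_⟩
    rw [Fin.sum_univ_add]
    simp only [Fin.append_left, Fin.append_right]
    rw [h, h']
    exact (map_add (repMapEquiv (R := R) (op c) (op c)) _ _).symm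
  smul_mem' := by
    rintro b a ⟨n, s, r, h⟩
    refine ⟨n, s, fun i => r i ≫ repMap (Quiver.Hom.op (b : c ⟶ c)), ?_⟩
    simp only [← Category.assoc]
    rw [← Preadditive.sum_comp, h]
    exact (repMap_comp (Quiver.Hom.op (b : c ⟶ c)) (Quiver.Hom.op (a : c ⟶ c))).symm

theorem mem_traceIdeal {Q : FPMod R Cᵒᵖ} {c : C} {a : End c} : a ∈ traceIdeal Q c ↔
    ∃ (n : ℕ) (s : Fin n → (rep R (op c) ⟶ Q)) (r : Fin n → (Q ⟶ rep R (op c))),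
      ∑ i, s i ≫ r i = repMap (Quiver.Hom.op (a : c ⟶ c)) := Iff.rfl

theorem mul_mem_traceIdeal {Q : FPMod R Cᵒᵖ} {c : C} {a : End c} (ha : a ∈ traceIdeal Q c)
    (b : End c) : a * b ∈ traceIdeal Q c := by
  obtain ⟨n, s, r, h⟩ := ha
  refine ⟨n, fun i => repMap (Quiver.Hom.op (b : c ⟶ c)) ≫ s i, r, ?_⟩
  simp only [Category.assoc]
  rw [← Preadditive.comp_sum, h]
  exact (repMap_comp (Quiver.Hom.op (a : c ⟶ c)) (Quiver.Hom.op (b : c ⟶ c))).symm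

end Trace

/-! ### add(J) is dual to add(Hom(-, c)) -/

section Envelope

variable {R : Type v} [CommRing R] {C : Type u} [Category.{v} C] [Preadditive C] [Linear R C]
variable {E : ModuleCat.{v} R} {c : C}
variable (h : ∀ M : (FPMod R C)ᵒᵖ, IsFinitelyPresented R Cᵒᵖ
      (((IsFinitelyPresented R C).ι.op ⋙ dualFunctor R C E).obj M)) [(dual h).IsEquivalence]

/-- If the dual of `J` is a summand of a sum of copies of `Hom(-, c)` and maps onto the dual of
the top of `Hom(c, -)`, then `Hom(-, c)` is a summand of a sum of copies of the dual of `J`. -/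
theorem isInAdd_rep_of_top [IsArtinianRing R] [HasFiniteBiproducts C]
    (hf : ∀ X Y : C, Module.Finite R (X ⟶ Y)) (hE : IsInjectiveCogenerator E)
    {T J : FPMod R C} (q : rep R c ⟶ T)
    (hq : ∀ (z : C) (g : c ⟶ z), ev q z (el g) = 0 ↔
        ∀ a : z ⟶ c, End.of (g ≫ a) ∈ Ring.jacobson (End c))
    (f : T ⟶ J) [Mono f] (hJ : IsInAdd (rep R (op c)) ((dual h).obj (op J))) :
    IsInAdd ((dual h).obj (op J)) (rep R (op c)) := by
  have := hasFiniteBiproducts_op (C := C)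
  have : Module.Finite R (End c) := hf c c
  have : IsArtinianRing (End c) := IsArtinianRing.of_finite R (End c)
  obtain ⟨n, s, r, hsr⟩ := hJ
  have hπ : Epi ((dual h).map f.op) := (epi_dual_iff h f).2 inferInstance
  have htop : traceIdeal ((dual h).obj (op J)) c = ⊤ := by
    refine eq_top_of_annihilator_le_jacobson _ (fun a ha b => mul_mem_traceIdeal ha b)
      fun b hb => ?_
    suffices hb0 : ev q c (el (b : c ⟶ c)) = 0 by
      have := (hq c b).1 hb0 (𝟙 c)
      rwa [Category.comp_id] at this
    by_contra hne
    obtain ⟨φ, hφ⟩ := hE.exists_ne_zero _ _ hne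
    obtain ⟨y, hy⟩ := epi_iff_surjective.1 hπ (op c) (dualEl h T c φ)
    let k : Fin n → (op c ⟶ op c) := fun i => el.symm (ev (s i) (op c) y)
    have hk : ∀ i, End.of (k i).unop ∈ traceIdeal ((dual h).obj (op J)) c := fun i => by
      refine mem_traceIdeal.2 ⟨1, fun _ => yo y, fun _ => s i, ?_⟩
      rw [Fin.sum_univ_one, yo_comp]
      exact congrArg yo (LinearEquiv.apply_symm_apply _ _).symm
    choose ψ hψ using fun i => (dualEl h T c).surjective
      (ev (r i ≫ (dual h).map f.op) (op c) (el (𝟙 (op c))))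
    -- The lift `y` of `φ` is expanded along the retraction of Hom(-, c)ⁿ onto the dual of `J`. Each
    -- `k i` lies in the trace ideal, so `q` kills `b ≫ k i`, contradicting that φ is nonzero on the
    -- class of b.
    have hsum : φ = ∑ i, ψ i ∘ₗ act T (k i).unop := by
      apply (dualEl h T c).injective
      rw [map_sum, ← hy]
      have hy' : y = ∑ i, ev (r i) (op c) (ev (s i) (op c) y) := by
        simpa using (congrArg (fun g => ev g _ y) hsr).symm
      conv_lhs => rw [hy']
      rw [map_sum]
      refine Finset.sum_congr rfl fun i _ => ?_
      rw [← act_dual, hψ, ← ev_comp, ev_rep]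
      rfl
    refine hφ ?_
    rw [hsum, LinearMap.sum_apply]
    refine Finset.sum_eq_zero fun i _ => ?_
    rw [LinearMap.comp_apply, ← ev_act, act_el]
    have : ev q c (el ((b : c ⟶ c) ≫ (k i).unop)) = 0 := (hq c _).2 fun a =>
      (Ring.jacobson (End c)).mul_mem_left (End.of a) (hb _ (hk i))
    rw [this, map_zero]
  obtain ⟨m, s', r', h'⟩ := mem_traceIdeal.1 (htop ▸ Submodule.mem_top :
    (1 : End c) ∈ traceIdeal ((dual h).obj (op J)) c)
  exact ⟨m, s', r', h'.trans repMap_id⟩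

/-- The envelope `J` of the top of `Hom(c, -)` exists, and `add(J)` is dual to
`add(Hom(-, c))`. -/
theorem exists_isEnvelopeOfTop [IsArtinianRing R] [HasFiniteBiproducts C]
    [IsIdempotentComplete C] (hf : ∀ X Y : C, Module.Finite R (X ⟶ Y))
    (hE : IsInjectiveCogenerator E) (c : C) :
    (∃ J, IsEnvelopeOfTop (rep R c) J) ∧ ∀ J, IsEnvelopeOfTop (rep R c) J →
      ∀ I : FPMod R C, IsInAdd (rep R (op c)) ((dual h).obj (op I)) ↔ IsInAdd J I := by
  obtain ⟨T, eT, q, hqs, hq, n, J₀, e, t, ht⟩ := exists_top h hf hE c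
  constructor
  · obtain ⟨J, f, hJ⟩ := exists_isInjectiveEnvelope h hf e t
    exact ⟨J, T, eT, f, hJ⟩
  · rintro J ⟨T', eT', f', hf'⟩ I
    let i : T ≅ T' := (IsFinitelyPresented R C).isoMk (eT ≪≫ eT'.symm)
    have := hf'.mono
    have := hf'.injective
    let t' : T' ⟶ J₀ := i.inv ≫ t
    have hJ₀ : IsInAdd (rep R (op c)) ((dual h).obj (op J₀)) :=
      (isInAdd_rep_op_biproduct c n).congr (Iso.refl _) e.symm
    have : Injective J₀ := (projective_dual_iff h J₀).1 (by
      have := hasFiniteBiproducts_op (C := C)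
      exact hJ₀.projective)
    -- Essentiality makes this extension a monomorphism, and injectivity of `J` splits it.
    let g : J ⟶ J₀ := Injective.factorThru t' f'
    have hg : f' ≫ g = t' := Injective.comp_factorThru t' f'
    have : Mono g := hf'.essential g (by rw [hg]; infer_instance)
    have hJ : IsInAdd (rep R (op c)) ((dual h).obj (op J)) := by
      refine isInAdd_of_retract hJ₀ ((dual h).map (Injective.factorThru (𝟙 J) g).op)
        ((dual h).map g.op) ?_
      rw [← Functor.map_comp, ← op_comp, Injective.comp_factorThru, op_id,
        CategoryTheory.Functor.map_id]
    have hJ' := isInAdd_rep_of_top h hf hE q hq (i.hom ≫ f') hJ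
    rw [← isInAdd_dual_iff h]
    exact ⟨fun hI => hJ'.trans hI, fun hI => hJ.trans hI⟩

/-- As `injSub` quantifies over envelopes, the translation needs both that one exists and that
add(J) is the same for all of them. The criterion of (b) is then applied to `op c`. -/
theorem injSub_eq_iff_hasDualBases [IsArtinianRing R] [HasFiniteBiproducts C]
    [IsIdempotentComplete C]
    (h : ∀ M : (FPMod R C)ᵒᵖ, IsFinitelyPresented R Cᵒᵖ
      (((IsFinitelyPresented R C).ι.op ⋙ dualFunctor R C E).obj M)) [(dual h).IsEquivalence]
    (hf : ∀ X Y : C, Module.Finite R (X ⟶ Y)) (hE : IsInjectiveCogenerator E) (c : C) :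
    (∀ Y : FPMod R C, injSub (rep R c) 1 Y → injSub (rep R c) ⊤ Y) ↔ HasDualBases (op c) := by
  have := hasFiniteBiproducts_op (C := C)
  have := hasKernels_op_of_equivalence (dual h)
  obtain ⟨⟨J₀, hJ₀⟩, hJ⟩ := exists_isEnvelopeOfTop h hf hE c
  have key : ∀ k (Y : FPMod R C), injSub (rep R c) k Y ↔
      projSub (rep R (op c)) k ((dual h).obj (op Y)) := fun k Y =>
    ⟨fun ⟨J, hJe, hI⟩ => (projSub_dual_iff h hE (hJ J hJe) k Y).2 hI,
      fun hY => ⟨J₀, hJ₀, (projSub_dual_iff h hE (hJ J₀ hJ₀) k Y).1 hY⟩⟩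
  rw [← projSub_eq_iff_hasDualBases (finite_hom_op hf)]
  simp only [key]
  refine ⟨fun H X hX => ?_, fun H Y => H _⟩
  obtain ⟨Y, ⟨e⟩⟩ := exists_dual_iso h X
  exact projSub_of_iso e (H Y (projSub_of_iso e.symm hX))

end Envelope

/-! ### Monotonicity in k and conclusion -/

section Monotone

variable {R : Type v} [CommRing R] {C : Type u} [Category.{v} C] [Preadditive C] [Linear R C]

theorem projSub_mono (P : FPMod R C) {k l : ℕ∞} (hkl : k ≤ l) : projSub P l ≤ projSub P k :=
  fun _ ⟨Q, d, ε, hQ, hε, h0, hd, hk⟩ =>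
    ⟨Q, d, ε, hQ, hε, h0, hd, fun n hn => hk n (hn.trans hkl)⟩

theorem injSub_mono (P : FPMod R C) {k l : ℕ∞} (hkl : k ≤ l) : injSub P l ≤ injSub P k :=
  fun _ ⟨J, hJ, I, d, η, hI, hη, h0, hd, hk⟩ =>
    ⟨J, hJ, I, d, η, hI, hη, h0, hd, fun n hn => hk n (hn.trans hkl)⟩

end Monotone

end DualizingVariety

theorem mainTheorem8 {R : Type v} [CommRing R] {C : Type u} [Category.{v} C] [Preadditive C]
    [Linear R C] (hC : DualizingVariety.IsDualizingVariety R C) (c : C) :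
    (DualizingVariety.injSub (DualizingVariety.rep R c) 1 =
        DualizingVariety.injSub (DualizingVariety.rep R c) ⊤ ↔
      ∀ c' : C, Module.Projective
        (DualizingVariety.endRing (DualizingVariety.rep R c))
        (DualizingVariety.rep R c ⟶ DualizingVariety.rep R c')) ∧
    (DualizingVariety.projSub (DualizingVariety.rep R c) 1 =
        DualizingVariety.projSub (DualizingVariety.rep R c) ⊤ ↔
      ∀ c' : C, Module.Projective
        (End (DualizingVariety.rep R c))
        (DualizingVariety.rep R c' ⟶ DualizingVariety.rep R c)) := by
  obtain ⟨hart, hadd, hidem, hf, E, ⟨j, hj⟩, h, hequiv⟩ := hC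
  have := hj.injective
  have := hj.mono
  have hE := DualizingVariety.isInjectiveCogenerator_of_mono j
  have : (DualizingVariety.dual h).IsEquivalence := hequiv
  have := DualizingVariety.hasKernels_of_equivalence (DualizingVariety.dual h)
  rw [← DualizingVariety.hasDualBases_iff_projective hf,
    ← DualizingVariety.hasDualBases_op_iff_projective hf,
    ← DualizingVariety.projSub_eq_iff_hasDualBases hf, ← DualizingVariety.injSub_eq_iff_hasDualBases h hf hE]
  exact ⟨⟨fun e Y hY => e ▸ hY,
      fun H => le_antisymm H (DualizingVariety.injSub_mono _ le_top)⟩,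
    ⟨fun e X hX => e ▸ hX, fun H => le_antisymm H (DualizingVariety.projSub_mono _ le_top)⟩⟩
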